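/- Let $d=d_\beta\ge 0$, and let $W_t=(y_t,x_t')'$, $t=1,2,\dots$, with $y_t$ real and $x_t\in\mathbb{R}^{1+d}$, follow the linear regression $$y_t=\theta'x_t+\varepsilon_t,\qquad \theta=(\gamma,\beta')'\in\Theta=[0,\infty)^{1+d},\quad \gamma\in\mathbb{R},\ \beta\in\mathbb{R}^{d}.$$ The distribution $\mathbb{P}_\psi$ of the data is determined by $\psi=(\theta,\phi)\in\Psi=\{(\theta,\phi):\theta\in\Theta,\ \phi\in\Phi(\theta)\}$, where $\Phi(\theta)\subset\Phi$ and $\Phi$ is a compact metric space which induces weak convergence of the bivariate distributions: if $\psi_n\to\psi_0$ with $\psi_n,\psi_0\in\Psi$, then for all $t,s\ge1$ the law of $(W_t,W_{t+s})$ under $\mathbb{P}_{\psi_n}$ converges weakly to its law under $\mathbb{P}_{\psi_0}$. Let $\Upsilon$ be the set of positive definite matrices with all eigenvalues in $[\kappa,\kappa^{-1}]$, for a fixed $\kappa>0$. Assume that there are constants $\nu,\nu'>0$ and $c,c'\in(0,\infty)$ such that for all $\psi\in\Psi$: 1. $\{(x_t',\varepsilon_t)'\}_{t\ge1}$ are i.i.d.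 under $\mathbb{P}_\psi$, with $\mathbb{E}_\psi|\varepsilon_t|<\infty$ and $\mathbb{E}_\psi[\varepsilon_t\mid x_t]=0$ almost surely; 2. $\mathbb{E}_\psi[x_tx_t']\in\Upsilon$ and $\mathbb{E}_\psi[x_tx_t'\varepsilon_t^2]\in\Upsilon$; 3. $\mathbb{E}_\psi|x_{j,t}|^{2+\nu}\le c$ and $\mathbb{E}_\psi|x_{j,t}\varepsilon_t|^{2+\nu}\le c$ for $j=1,\dots,1+d$; 4. $\mathbb{E}_\psi\left[|x_{i,t}x_{j,t}x_{k,t}x_{l,t}|^{1+\nu'}\right]\le c'$ for $i,j,k,l=1,\dots,1+d$. Put $S_{xx}=n^{-1}\sum_{t=1}^n x_tx_t'$, $S_{xy}=n^{-1}\sum_{t=1}^n x_ty_t$, $\hat\theta_{LS}=S_{xx}^{-1}S_{xy}$ and $\hat\Sigma_n=n^{-1}\sum_{t=1}^n\hat\varepsilon_t^2x_tx_t'$ with $\hat\varepsilon_t=y_t-x_t'\hat\theta_{LS}$. Let $\check\beta_n$ be the $\beta$-component of $\hat\theta_{LS}$, and let $\check\Sigma_{\beta,n}$ be the $d\times d$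 block of $S_{xx}^{-1}\hat\Sigma_nS_{xx}^{-1}$ that corresponds to $\beta$ (with $S_{xx}^{-1}$ given an arbitrary value, say $0$, when $S_{xx}$ is singular). Then for all $\psi_n=(\theta_n,\phi_n)\in\Psi$ with $\theta_n=(\gamma_n,\beta_n')'$, all $\psi_0=(\theta_0,\phi_0)\in\Psi$ and all $b\in[0,\infty]^d$ such that $\psi_n\to\psi_0$ and $\sqrt n\,\beta_n\to b$, and with $\Omega_0=\mathbb{E}_{\psi_0}[x_tx_t']$, $\Sigma_0=\mathbb{E}_{\psi_0}[x_tx_t'\varepsilon_t^2]$, the matrix $H_\beta$ that selects $H_\beta\theta=\beta$, and $\Sigma_\beta=H_\beta\Omega_0^{-1}\Sigma_0\Omega_0^{-1}H_\beta'$, the following hold under $\mathbb{P}_{\psi_n}$ as $n\to\infty$: - $\hat\Sigma_n\overset{p}{\to}\Sigma_0$; - $\sqrt n(\check\beta_n-\beta_n)\overset{d}{\to}N(0,\Sigma_\beta)$ and $\check\Sigma_{\beta,n}\overset{p}{\to}\Sigma_\beta$. -/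

import Mathlib

open MeasureTheory ProbabilityTheory Filter Topology Matrix
open scoped ENNReal

namespace BoundaryRegression

noncomputable section

/-- Regression coefficients `θ = (γ, β')'`: coordinate `0` is the scalar `γ`, and coordinate
`j.succ` is the `j`-th component of `β ∈ ℝ^d`. The same index set is used for the regressors. -/
abbrev Param (d : ℕ) : Type := Fin (d + 1) → ℝ

/-- The set of positive definite matrices whose eigenvalues lie in `[κ, κ⁻¹]`. -/
def boundedPosDef (m : ℕ) (κ : ℝ) : Set (Matrix (Fin m) (Fin m) ℝ) :=
  {A | A.PosDef ∧ ∃ hA : A.IsHermitian, ∀ i, κ ≤ hA.eigenvalues i ∧ hA.eigenvalues i ≤ κ⁻¹}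

/-- The parameter space `Ψ = {(θ, φ) : θ ∈ [0, ∞)^(1+d), φ ∈ Φ(θ)}`. -/
def paramSpace {d : ℕ} {Φ : Type*} (Φset : Param d → Set Φ) : Set (Param d × Φ) :=
  {ψ | (∀ i, 0 ≤ ψ.1 i) ∧ ψ.2 ∈ Φset ψ.1}

section Model

variable {d : ℕ} {Φ Ω : Type*}

/-- The `t`-th observation `W_t = (y_t, x_t')'`. -/
def obs (y : ℕ → Ω → ℝ) (x : ℕ → Ω → Param d) (t : ℕ) (ω : Ω) : ℝ × Param d :=
  (y t ω, x t ω)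

/-- The regression error `ε_t = y_t - θ'x_t` at the coefficient vector `θ`. -/
def err (y : ℕ → Ω → ℝ) (x : ℕ → Ω → Param d) (θ : Param d) (t : ℕ) (ω : Ω) : ℝ :=
  y t ω - θ ⬝ᵥ x t ω

/-- `S_xx = n⁻¹ ∑ x_t x_t'`, based on the first `n` observations. -/
def Sxx (x : ℕ → Ω → Param d) (n : ℕ) (ω : Ω) : Matrix (Fin (d + 1)) (Fin (d + 1)) ℝ :=
  Matrix.of fun i j => (n : ℝ)⁻¹ * ∑ t ∈ Finset.range n, x t ω i * x t ω j

/-- `S_xy = n⁻¹ ∑ x_t y_t`. -/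
def Sxy (y : ℕ → Ω → ℝ) (x : ℕ → Ω → Param d) (n : ℕ) (ω : Ω) : Param d :=
  fun i => (n : ℝ)⁻¹ * ∑ t ∈ Finset.range n, x t ω i * y t ω

/-- The unconstrained least-squares estimator `S_xx⁻¹ S_xy`. -/
def thetaLS (y : ℕ → Ω → ℝ) (x : ℕ → Ω → Param d) (n : ℕ) (ω : Ω) : Param d :=
  (Sxx x n ω)⁻¹ *ᵥ Sxy y x n ω

/-- The Eicker-White estimator `n⁻¹ ∑ ε̂_t² x_t x_t'` with the least-squares residuals `ε̂_t`. -/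
def sigmaHat (y : ℕ → Ω → ℝ) (x : ℕ → Ω → Param d) (n : ℕ) (ω : Ω) :
    Matrix (Fin (d + 1)) (Fin (d + 1)) ℝ :=
  Matrix.of fun i j => (n : ℝ)⁻¹ *
    ∑ t ∈ Finset.range n, err y x (thetaLS y x n ω) t ω ^ 2 * (x t ω i * x t ω j)

/-- The `β`-component of a coefficient vector. -/
def betaPart (θ : Param d) : Fin d → ℝ := fun j => θ j.succ

/-- The estimator of `β`: the `β`-component of unconstrained least squares. -/
def betaCheck (y : ℕ → Ω → ℝ) (x : ℕ → Ω → Param d) (n : ℕ) (ω : Ω) : Fin d → ℝ :=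
  betaPart (thetaLS y x n ω)

/-- The `β`-block of the sandwich matrix `S_xx⁻¹ Σ̂_n S_xx⁻¹`. -/
def sigmaBetaCheck (y : ℕ → Ω → ℝ) (x : ℕ → Ω → Param d) (n : ℕ) (ω : Ω) :
    Matrix (Fin d) (Fin d) ℝ :=
  ((Sxx x n ω)⁻¹ * sigmaHat y x n ω * (Sxx x n ω)⁻¹).submatrix Fin.succ Fin.succ

/-- The selection matrix with `selBeta d *ᵥ θ = β`. -/
def selBeta (d : ℕ) : Matrix (Fin d) (Fin (d + 1)) ℝ :=
  Matrix.of fun j i => if i = j.succ then 1 else 0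

/-- `Σ_β = H_β Ω₀⁻¹ Σ₀ Ω₀⁻¹ H_β'`. -/
def sigmaBeta (Om0 S0 : Matrix (Fin (d + 1)) (Fin (d + 1)) ℝ) : Matrix (Fin d) (Fin d) ℝ :=
  selBeta d * Om0⁻¹ * S0 * Om0⁻¹ * (selBeta d)ᵀ

variable [MeasurableSpace Ω]

/-- `E_P[x_t x_t']`, entry by entry. -/
def momXX (μ : Measure Ω) (x : ℕ → Ω → Param d) (t : ℕ) :
    Matrix (Fin (d + 1)) (Fin (d + 1)) ℝ :=
  Matrix.of fun i j => ∫ ω, x t ω i * x t ω j ∂μ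

/-- `E_P[x_t x_t' ε_t²]` with `ε_t = y_t - θ'x_t`, entry by entry. -/
def momXXee (μ : Measure Ω) (y : ℕ → Ω → ℝ) (x : ℕ → Ω → Param d) (θ : Param d) (t : ℕ) :
    Matrix (Fin (d + 1)) (Fin (d + 1)) ℝ :=
  Matrix.of fun i j => ∫ ω, x t ω i * x t ω j * err y x θ t ω ^ 2 ∂μ

/-- The topology on the parameters induces weak convergence of the bivariate distributions:
if `ψ_n → ψ₀` in `Ψ`, then for all `t` and all `s ≥ 1` the law of `(W_t, W_{t+s})` under `ψ_n`
converges weakly to its law under `ψ₀`. -/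
def InducesWeakConvergence [TopologicalSpace Φ] (Ψ : Set (Param d × Φ))
    (P : Param d × Φ → Measure Ω) [∀ ψ, IsProbabilityMeasure (P ψ)]
    (y : ℕ → Ω → ℝ) (x : ℕ → Ω → Param d) : Prop :=
  ∀ (ψ : ℕ → Param d × Φ) (ψ₀ : Param d × Φ), (∀ n, ψ n ∈ Ψ) → ψ₀ ∈ Ψ →
    Tendsto ψ atTop (𝓝 ψ₀) → ∀ t s : ℕ, 1 ≤ s →
      TendstoInDistribution (fun _ : ℕ => fun ω => (obs y x t ω, obs y x (t + s) ω)) atTop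
        (fun ω => (obs y x t ω, obs y x (t + s) ω)) (fun n => P (ψ n)) (P ψ₀)

/-- First group of assumptions on the i.i.d. linear regression. -/
structure LinIID1 (κ : ℝ) (Ψ : Set (Param d × Φ)) (P : Param d × Φ → Measure Ω)
    (y : ℕ → Ω → ℝ) (x : ℕ → Ω → Param d) : Prop where
  indep : ∀ ψ ∈ Ψ, iIndepFun (fun t ω => (x t ω, err y x ψ.1 t ω)) (P ψ)
  ident : ∀ ψ ∈ Ψ, ∀ t, IdentDistrib (fun ω => (x t ω, err y x ψ.1 t ω))
    (fun ω => (x 0 ω, err y x ψ.1 0 ω)) (P ψ) (P ψ)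
  integrable_err : ∀ ψ ∈ Ψ, ∀ t, Integrable (err y x ψ.1 t) (P ψ)
  condExp_err : ∀ ψ ∈ Ψ, ∀ t,
    (P ψ)[err y x ψ.1 t | MeasurableSpace.comap (x t) inferInstance] =ᵐ[P ψ] 0
  momXX_mem : ∀ ψ ∈ Ψ, ∀ t, momXX (P ψ) x t ∈ boundedPosDef (d + 1) κ
  momXXee_mem : ∀ ψ ∈ Ψ, ∀ t, momXXee (P ψ) y x ψ.1 t ∈ boundedPosDef (d + 1) κ
  moments : ∃ ν c : ℝ, 0 < ν ∧ ∀ ψ ∈ Ψ, ∀ t, ∀ j : Fin (d + 1),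
    ∫⁻ ω, ENNReal.ofReal (|x t ω j| ^ (2 + ν)) ∂(P ψ) ≤ ENNReal.ofReal c ∧
    ∫⁻ ω, ENNReal.ofReal (|x t ω j * err y x ψ.1 t ω| ^ (2 + ν)) ∂(P ψ) ≤ ENNReal.ofReal c

/-- Second assumption: uniformly bounded moments of order slightly above four. -/
def LinIID2 (Ψ : Set (Param d × Φ)) (P : Param d × Φ → Measure Ω)
    (x : ℕ → Ω → Param d) : Prop :=
  ∃ ν c : ℝ, 0 < ν ∧ 0 < c ∧ ∀ ψ ∈ Ψ, ∀ t, ∀ i j k l : Fin (d + 1),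
    ∫⁻ ω, ENNReal.ofReal (|x t ω i * x t ω j * x t ω k * x t ω l| ^ (1 + ν)) ∂(P ψ)
      ≤ ENNReal.ofReal c

/-- Drifting sequences: `ψ_n → ψ₀` in `Ψ` and `√n β_n → b ∈ [0, ∞]^d`. -/
structure IsDrifting [TopologicalSpace Φ] (Ψ : Set (Param d × Φ)) (ψ : ℕ → Param d × Φ)
    (ψ₀ : Param d × Φ) (b : Fin d → ℝ≥0∞) : Prop where
  mem : ∀ n, ψ n ∈ Ψ
  mem_limit : ψ₀ ∈ Ψ
  tendsto : Tendsto ψ atTop (𝓝 ψ₀)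
  tendsto_beta : ∀ j,
    Tendsto (fun n : ℕ => ENNReal.ofReal (√(n : ℝ) * betaPart (ψ n).1 j)) atTop (𝓝 (b j))

/-- Convergence in probability, entry by entry, of random matrices `A n` under the measures
`μ n` to a constant matrix `B`. -/
def MatrixTendstoInProb {m : ℕ} (μ : ℕ → Measure Ω) (A : ℕ → Ω → Matrix (Fin m) (Fin m) ℝ)
    (B : Matrix (Fin m) (Fin m) ℝ) : Prop :=
  ∀ i j, ∀ δ : ℝ, 0 < δ → Tendsto (fun n => μ n {ω | δ ≤ |A n ω i j - B i j|}) atTop (𝓝 0)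

/-- Consistency of `Σ̂_n` for `Σ₀` along `P_{ψ_n}`. -/
def CovarianceConsistency (μ : ℕ → Measure Ω)
    (S : ℕ → Ω → Matrix (Fin (d + 1)) (Fin (d + 1)) ℝ)
    (S0 : Matrix (Fin (d + 1)) (Fin (d + 1)) ℝ) : Prop :=
  MatrixTendstoInProb μ S S0

/-- (i) `√n (β̌_n - β_n)` converges in distribution to `N(0, Σ_β)` and (ii) `Σ̌_{β,n}` converges
in probability to `Σ_β`, both along the probability measures `μ n = P_{ψ_n}`. -/
structure AsymptoticNormality (μ : ℕ → Measure Ω) [∀ n, IsProbabilityMeasure (μ n)]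
    (β : ℕ → Fin d → ℝ) (bhat : ℕ → Ω → Fin d → ℝ)
    (Sβ : ℕ → Ω → Matrix (Fin d) (Fin d) ℝ)
    (Om0 S0 : Matrix (Fin (d + 1)) (Fin (d + 1)) ℝ) : Prop where
  normal : TendstoInDistribution
    (fun (n : ℕ) ω => WithLp.toLp 2 (fun j => √(n : ℝ) * (bhat n ω j - β n j)) :
      (n : ℕ) → Ω → EuclideanSpace ℝ (Fin d))
    atTop id μ (multivariateGaussian 0 (sigmaBeta Om0 S0))
  covariance : MatrixTendstoInProb μ Sβ (sigmaBeta Om0 S0)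

end Model

end

end BoundaryRegression

/-! The law of the data moves with `n`, so the argument is a triangular-array version of the
classical analysis of least squares. Writing the score as `n⁻¹ ∑ x_t ε_t`, one has `θ̂ - θ_n =
S_xx⁻¹ · score` whenever `S_xx` is nonsingular, an event whose probability tends to one.

Three facts about arrays with i.i.d. rows carry the proof. `tendstoInProb_mean` is a weak law under
a bounded moment of order `1 + η`, obtained by truncation and a variance bound.
`tendsto_charFun_inv_sqrt_mul_sum` is a Lyapunov central limit theorem, obtained from a Taylor bound
on the characteristic function. `TendstoInProb.mul_boundedInMean` says that `o_p(1)` times an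
`L¹`-bounded sequence is `o_p(1)`.

`exists_regressionArray` supplies their input. Weak convergence of the laws and `θ_n → θ₀` give
convergence of bounded continuous functionals of the data and parameter. The uniform moment bounds
make the second moments uniformly integrable, so these converge to `Ω₀` and `Σ₀`.

For `Σ̂_n`, the squared residuals are expanded in powers of `θ̂ - θ_n`: the leading term obeys the
weak law, and the other terms are vanishing coefficients times averages bounded in mean. For
normality, `S_xx⁻¹` may be replaced by `Ω₀⁻¹` because the scaled score is bounded in mean. Every
linear combination of the scaled score satisfies the scalar central limit theorem, and Lévy's
continuity theorem concludes. -/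

namespace BoundaryRegression

/-! ### Convergence in probability under a varying sequence of measures. -/

section InProbability

variable {Ω E F : Type*} [MeasurableSpace Ω] [TopologicalSpace E] [TopologicalSpace F]

/-- Convergence in probability of the random elements `V n` under the measures `μ n` to a constant
`v`, in terms of neighbourhoods of `v`. -/
def TendstoInProb (μ : ℕ → Measure Ω) (V : ℕ → Ω → E) (v : E) : Prop :=
  ∀ U ∈ 𝓝 v, Tendsto (fun n => μ n {ω | V n ω ∉ U}) atTop (𝓝 0)

variable {μ : ℕ → Measure Ω}

lemma tendsto_measure_zero_of_subset {A B : ℕ → Set Ω} (h : ∀ n, A n ⊆ B n)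
    (hB : Tendsto (fun n => μ n (B n)) atTop (𝓝 0)) :
    Tendsto (fun n => μ n (A n)) atTop (𝓝 0) :=
  tendsto_of_tendsto_of_tendsto_of_le_of_le tendsto_const_nhds hB (fun _ => zero_le)
    (fun n => measure_mono (h n))

lemma tendsto_measure_zero_union {A B : ℕ → Set Ω}
    (hA : Tendsto (fun n => μ n (A n)) atTop (𝓝 0))
    (hB : Tendsto (fun n => μ n (B n)) atTop (𝓝 0)) :
    Tendsto (fun n => μ n (A n ∪ B n)) atTop (𝓝 0) := by
  refine tendsto_of_tendsto_of_tendsto_of_le_of_le tendsto_const_nhds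
    (by simpa using hA.add hB) (fun _ => zero_le) (fun n => measure_union_le _ _)

lemma TendstoInProb.comp {V : ℕ → Ω → E} {v : E} (hV : TendstoInProb μ V v) {f : E → F}
    (hf : ContinuousAt f v) : TendstoInProb μ (fun n ω => f (V n ω)) (f v) :=
  fun U hU => hV (f ⁻¹' U) (hf hU)

/-- Allows identities that hold only where `S_xx` is invertible; the value assigned to the inverse
elsewhere is then irrelevant. -/
lemma TendstoInProb.congr {V W : ℕ → Ω → E} {v : E} (hV : TendstoInProb μ V v)
    (h : Tendsto (fun n => μ n {ω | V n ω ≠ W n ω}) atTop (𝓝 0)) : TendstoInProb μ W v := by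
  intro U hU
  refine tendsto_measure_zero_of_subset (fun n ω hω => ?_) (tendsto_measure_zero_union (hV U hU) h)
  by_cases h' : V n ω = W n ω
  · left; simpa [h'] using hω
  · right; exact h'

lemma TendstoInProb.prodMk {V : ℕ → Ω → E} {v : E} {W : ℕ → Ω → F} {w : F}
    (hV : TendstoInProb μ V v) (hW : TendstoInProb μ W w) :
    TendstoInProb μ (fun n ω => (V n ω, W n ω)) (v, w) := by
  intro U hU
  rw [nhds_prod_eq] at hU
  obtain ⟨A, hA, B, hB, hAB⟩ := Filter.mem_prod_iff.1 hU
  refine tendsto_measure_zero_of_subset (fun n ω hω => ?_)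
    (tendsto_measure_zero_union (hV A hA) (hW B hB))
  by_contra hcon
  simp only [Set.mem_union, Set.mem_ofPred_eq, not_or, not_not] at hcon
  exact hω (hAB ⟨hcon.1, hcon.2⟩)

lemma TendstoInProb.pi {ι : Type*} [Finite ι] {E : ι → Type*} [∀ i, TopologicalSpace (E i)]
    {V : ℕ → Ω → ∀ i, E i} {v : ∀ i, E i}
    (hV : ∀ i, TendstoInProb μ (fun n ω => V n ω i) (v i)) : TendstoInProb μ V v := by
  cases nonempty_fintype ι
  intro U hU
  rw [nhds_pi] at hU
  obtain ⟨I, -, t, ht, hU⟩ := Filter.mem_pi.1 hU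
  have : Tendsto (fun n => ∑ i, μ n {ω | V n ω i ∉ t i}) atTop (𝓝 0) := by
    simpa using tendsto_finsetSum Finset.univ (fun i _ => hV i (t i) (ht i))
  refine tendsto_of_tendsto_of_tendsto_of_le_of_le tendsto_const_nhds this (fun _ => zero_le)
    (fun n => ?_)
  refine (measure_mono ?_).trans (measure_iUnion_fintype_le (μ n) _)
  intro ω hω
  by_contra hcon
  simp only [Set.mem_iUnion, Set.mem_ofPred_eq, not_exists, not_not] at hcon
  exact hω (hU fun i _ => hcon i)

lemma tendstoInProb_const (v : ℕ → E) {v₀ : E} (hv : Tendsto v atTop (𝓝 v₀)) :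
    TendstoInProb μ (fun n _ => v n) v₀ := by
  intro U hU
  refine tendsto_const_nhds.congr' ?_
  filter_upwards [hv hU] with n hn
  have : v n ∈ U := hn
  simp [this]

lemma tendstoInProb_real_iff {V : ℕ → Ω → ℝ} {v : ℝ} :
    TendstoInProb μ V v ↔
      ∀ δ : ℝ, 0 < δ → Tendsto (fun n => μ n {ω | δ ≤ |V n ω - v|}) atTop (𝓝 0) := by
  constructor
  · intro h δ hδ
    have := h _ (Metric.ball_mem_nhds v hδ)
    simpa [Metric.mem_ball, Real.dist_eq] using this
  · intro h U hU
    obtain ⟨δ, hδ, hU⟩ := Metric.mem_nhds_iff.1 hU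
    refine tendsto_measure_zero_of_subset (fun n ω hω => ?_) (h δ hδ)
    by_contra hcon
    simp only [Set.mem_ofPred_eq, not_le] at hcon
    exact hω (hU (by simpa [Real.dist_eq] using hcon))

lemma TendstoInProb.add {V W : ℕ → Ω → ℝ} {v w : ℝ}
    (hV : TendstoInProb μ V v) (hW : TendstoInProb μ W w) :
    TendstoInProb μ (fun n ω => V n ω + W n ω) (v + w) :=
  (hV.prodMk hW).comp (f := fun p : ℝ × ℝ => p.1 + p.2) (by fun_prop)

lemma TendstoInProb.mul {V W : ℕ → Ω → ℝ} {v w : ℝ}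
    (hV : TendstoInProb μ V v) (hW : TendstoInProb μ W w) :
    TendstoInProb μ (fun n ω => V n ω * W n ω) (v * w) :=
  (hV.prodMk hW).comp (f := fun p : ℝ × ℝ => p.1 * p.2) (by fun_prop)

lemma TendstoInProb.const_mul {V : ℕ → Ω → ℝ} {v : ℝ} (c : ℝ)
    (hV : TendstoInProb μ V v) : TendstoInProb μ (fun n ω => c * V n ω) (c * v) :=
  hV.comp (f := fun p : ℝ => c * p) (by fun_prop)

lemma TendstoInProb.sum {ι : Type*} (s : Finset ι) {V : ι → ℕ → Ω → ℝ} {v : ι → ℝ}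
    (hV : ∀ i ∈ s, TendstoInProb μ (V i) (v i)) :
    TendstoInProb μ (fun n ω => ∑ i ∈ s, V i n ω) (∑ i ∈ s, v i) := by
  classical
  induction s using Finset.induction_on with
  | empty => simpa using tendstoInProb_const (fun _ => (0 : ℝ)) tendsto_const_nhds
  | insert a s ha ih =>
    simp only [Finset.sum_insert ha]
    exact (hV a (by simp)).add (ih fun i hi => hV i (by simp [hi]))

/-- Boundedness in `L¹`, uniformly along the sequence of measures. -/
def BoundedInMean (μ : ℕ → Measure Ω) (V : ℕ → Ω → ℝ) : Prop :=
  ∃ C : ℝ, ∀ n, Integrable (V n) (μ n) ∧ ∫ ω, |V n ω| ∂(μ n) ≤ C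

lemma measure_le_abs_le {ν : Measure Ω} [IsProbabilityMeasure ν] {X : Ω → ℝ} (hX : Integrable X ν)
    {C K : ℝ} (hC : ∫ ω, |X ω| ∂ν ≤ C) (hK : 0 < K) :
    ν {ω | K ≤ |X ω|} ≤ ENNReal.ofReal (C / K) := by
  have := mul_meas_ge_le_integral_of_nonneg (ae_of_all ν fun ω => abs_nonneg (X ω)) hX.abs K
  rw [← ofReal_measureReal]
  refine ENNReal.ofReal_le_ofReal ?_
  rw [le_div_iff₀ hK, mul_comm]
  exact this.trans hC

variable [∀ n, IsProbabilityMeasure (μ n)]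

lemma tendstoInProb_of_tendsto_integral {V : ℕ → Ω → ℝ} {v : ℝ}
    (hV : ∀ n, Integrable (V n) (μ n))
    (h : Tendsto (fun n => ∫ ω, |V n ω - v| ∂(μ n)) atTop (𝓝 0)) : TendstoInProb μ V v := by
  rw [tendstoInProb_real_iff]
  intro δ hδ
  have h1 : Tendsto (fun n => ENNReal.ofReal ((∫ ω, |V n ω - v| ∂(μ n)) / δ)) atTop (𝓝 0) := by
    have := ENNReal.tendsto_ofReal (h.div_const δ)
    simpa using this
  exact tendsto_of_tendsto_of_tendsto_of_le_of_le tendsto_const_nhds h1 (fun _ => zero_le)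
    (fun n => measure_le_abs_le ((hV n).sub (integrable_const v)) le_rfl hδ)

/-- If the product is at least `δ`, then either `|W| ≥ K` or `|V| ≥ δ / K`. Markov's inequality
makes the first event rare uniformly in `n` for large `K`, and the second vanishes for each fixed
`K`. -/
lemma TendstoInProb.mul_boundedInMean {V W : ℕ → Ω → ℝ}
    (hV : TendstoInProb μ V 0) (hW : BoundedInMean μ W) :
    TendstoInProb μ (fun n ω => V n ω * W n ω) 0 := by
  obtain ⟨C, hC⟩ := hW
  have hC0 : 0 ≤ C := (integral_nonneg fun ω => abs_nonneg _).trans (hC 0).2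
  rw [tendstoInProb_real_iff] at hV ⊢
  intro δ hδ
  rw [ENNReal.tendsto_nhds_zero]
  intro e he
  rcases eq_or_ne e ∞ with rfl | he'
  · simp
  have her : 0 < e.toReal := ENNReal.toReal_pos he.ne' he'
  -- Chosen so that the Markov bound `C / K` is at most `e / 2`; the `+ 1` keeps `K` positive when
  -- `C = 0`.
  set K : ℝ := 2 * (C + 1) / e.toReal with hKdef
  have hK : 0 < K := by positivity
  have hCK : ENNReal.ofReal (C / K) ≤ e / 2 := by
    have : C / K ≤ e.toReal / 2 := by
      rw [div_le_iff₀ hK, hKdef]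
      field_simp
      linarith
    calc ENNReal.ofReal (C / K) ≤ ENNReal.ofReal (e.toReal / 2) := ENNReal.ofReal_le_ofReal this
      _ = e / 2 := by
        rw [ENNReal.ofReal_div_of_pos (by norm_num), ENNReal.ofReal_toReal he']; simp
  have h1 := (ENNReal.tendsto_nhds_zero.1 (hV (δ / K) (by positivity))) (e / 2)
    (ENNReal.half_pos he.ne')
  filter_upwards [h1] with n hn
  calc μ n {ω | δ ≤ |V n ω * W n ω - 0|}
      ≤ μ n ({ω | δ / K ≤ |V n ω - 0|} ∪ {ω | K ≤ |W n ω|}) := by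
        refine measure_mono fun ω hω => ?_
        by_contra hcon
        simp only [Set.mem_union, Set.mem_ofPred_eq, not_or, not_le, sub_zero] at hcon hω
        rw [abs_mul] at hω
        have : |V n ω| * |W n ω| < δ / K * K :=
          mul_lt_mul'' hcon.1 hcon.2 (abs_nonneg _) (abs_nonneg _)
        rw [div_mul_cancel₀ _ hK.ne'] at this
        linarith
    _ ≤ e / 2 + e / 2 := (measure_union_le _ _).trans
        (add_le_add hn ((measure_le_abs_le (hC n).1 (hC n).2 hK).trans hCK))
    _ = e := ENNReal.add_halves e

end InProbability

/-! ### Truncation and absolute moments. -/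

section Moments

variable {Ω : Type*} [MeasurableSpace Ω]

/-- Truncation of a real number at the levels `-K` and `K`. -/
noncomputable def truncate (K u : ℝ) : ℝ := max (-K) (min K u)

lemma continuous_truncate (K : ℝ) : Continuous (truncate K) := by
  unfold truncate; fun_prop

lemma abs_truncate_le {K : ℝ} (hK : 0 ≤ K) (u : ℝ) : |truncate K u| ≤ K := by
  unfold truncate
  rw [abs_le]
  exact ⟨le_max_left _ _, max_le (by linarith) (min_le_left _ _)⟩

/-- The error vanishes for `|u| ≤ K`. Beyond that it is at most `|u|`, and `1 ≤ (|u| / K) ^ η`. -/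
lemma abs_sub_truncate_le {K η : ℝ} (hK : 0 < K) (hη : 0 < η) (u : ℝ) :
    |u - truncate K u| ≤ K ^ (-η) * |u| ^ (1 + η) := by
  by_cases h : |u| ≤ K
  · have h' := abs_le.1 h
    have : truncate K u = u := by
      unfold truncate; rw [min_eq_right h'.2, max_eq_right h'.1]
    rw [this, sub_self, abs_zero]; positivity
  · push Not at h
    have hu : 0 < |u| := hK.trans h
    have h1 : |u - truncate K u| ≤ |u| := by
      unfold truncate
      rcases le_or_gt 0 u with h0 | h0
      · rw [abs_of_nonneg h0] at h
        rw [min_eq_left h.le, max_eq_right (by linarith), abs_of_nonneg h0,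
          abs_of_nonneg (by linarith)]
        linarith
      · rw [abs_of_neg h0] at h
        rw [min_eq_right (by linarith), max_eq_left (by linarith), abs_of_neg h0,
          abs_of_nonpos (by linarith)]
        linarith
    refine h1.trans ?_
    rw [Real.rpow_add hu, Real.rpow_one, Real.rpow_neg hK.le]
    have h2 : K ^ η ≤ |u| ^ η := Real.rpow_le_rpow hK.le h.le hη.le
    have h3 : 0 < K ^ η := by positivity
    rw [mul_comm, mul_assoc]
    refine le_mul_of_one_le_right hu.le ?_
    rw [← div_eq_mul_inv, one_le_div h3]
    exact h2

/-- A pointwise substitute for Cauchy–Schwarz: the product is at most the square of the larger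
factor. Constants are immaterial, since only uniform boundedness is needed. -/
lemma abs_mul_rpow_le (a b : ℝ) {p : ℝ} (hp : 0 ≤ p) :
    |a * b| ^ p ≤ |a| ^ (2 * p) + |b| ^ (2 * p) := by
  have key : ∀ x : ℝ, (|x| * |x|) ^ p = |x| ^ (2 * p) := fun x => by
    rw [Real.rpow_mul (abs_nonneg _), Real.rpow_two, sq]
  rw [abs_mul, ← key a, ← key b]
  rcases le_total |a| |b| with h | h
  · refine (Real.rpow_le_rpow (by positivity)
      (mul_le_mul_of_nonneg_right h (abs_nonneg b)) hp).trans ?_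
    exact le_add_of_nonneg_left (by positivity)
  · refine (Real.rpow_le_rpow (by positivity)
      (mul_le_mul_of_nonneg_left h (abs_nonneg a)) hp).trans ?_
    exact le_add_of_nonneg_right (by positivity)

lemma abs_rpow_le_one_add {p q : ℝ} (hp : 0 ≤ p) (hpq : p ≤ q) (u : ℝ) :
    |u| ^ p ≤ 1 + |u| ^ q := by
  rcases le_total |u| 1 with h | h
  · exact (Real.rpow_le_one (abs_nonneg _) h hp).trans (le_add_of_nonneg_right (by positivity))
  · exact (Real.rpow_le_rpow_of_exponent_le h hpq).trans (le_add_of_nonneg_left zero_le_one)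

/-- The absolute moment of order `p` is finite and at most `C`. -/
structure MomentBound (P : Measure Ω) (X : Ω → ℝ) (p C : ℝ) : Prop where
  integrable : Integrable (fun ω => |X ω| ^ p) P
  le : ∫ ω, |X ω| ^ p ∂P ≤ C

variable {P : Measure Ω}

/-- The bound is `max c 0` because `ENNReal.ofReal` sends a negative `c` to zero. -/
lemma momentBound_of_lintegral_le {X : Ω → ℝ} (hX : Measurable X) {p c : ℝ}
    (h : ∫⁻ ω, ENNReal.ofReal (|X ω| ^ p) ∂P ≤ ENNReal.ofReal c) :
    MomentBound P X p (max c 0) := by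
  have hm : Measurable fun ω => |X ω| ^ p := by fun_prop
  have h0 : 0 ≤ᵐ[P] fun ω => |X ω| ^ p := ae_of_all _ fun ω => by positivity
  refine ⟨⟨hm.aestronglyMeasurable, ?_⟩, ?_⟩
  · rw [hasFiniteIntegral_iff_ofReal h0]
    exact h.trans_lt ENNReal.ofReal_lt_top
  · rw [integral_eq_lintegral_of_nonneg_ae h0 hm.aestronglyMeasurable]
    refine (ENNReal.toReal_mono ENNReal.ofReal_ne_top h).trans ?_
    rw [ENNReal.toReal_ofReal']

lemma MomentBound.of_le {X Y : Ω → ℝ} {p C : ℝ} (hX : Measurable X)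
    (hY : Integrable Y P) (hle : ∀ ω, |X ω| ^ p ≤ Y ω) (hC : ∫ ω, Y ω ∂P ≤ C) :
    MomentBound P X p C := by
  have hm : Measurable fun ω => |X ω| ^ p := by fun_prop
  have hi : Integrable (fun ω => |X ω| ^ p) P := by
    refine hY.mono' hm.aestronglyMeasurable (ae_of_all _ fun ω => ?_)
    rw [Real.norm_of_nonneg (by positivity)]
    exact hle ω
  exact ⟨hi, (integral_mono hi hY hle).trans hC⟩

lemma MomentBound.mul {X Y : Ω → ℝ} {p C D : ℝ} (hp : 0 ≤ p) (mX : Measurable X)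
    (mY : Measurable Y) (hX : MomentBound P X (2 * p) C) (hY : MomentBound P Y (2 * p) D) :
    MomentBound P (fun ω => X ω * Y ω) p (C + D) :=
  .of_le (mX.mul mY) (hX.integrable.add hY.integrable)
    (fun ω => abs_mul_rpow_le (X ω) (Y ω) hp)
    (by
      simp only [Pi.add_apply]
      rw [integral_add hX.integrable hY.integrable]
      exact add_le_add hX.le hY.le)

lemma MomentBound.const_mul {X : Ω → ℝ} {p C : ℝ} (hX : MomentBound P X p C) (a : ℝ) :
    MomentBound P (fun ω => a * X ω) p (|a| ^ p * C) := by
  have : ∀ ω, |a * X ω| ^ p = |a| ^ p * |X ω| ^ p := fun ω => by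
    rw [abs_mul, Real.mul_rpow (abs_nonneg _) (abs_nonneg _)]
  refine ⟨by simpa only [this] using hX.integrable.const_mul _, ?_⟩
  simp only [this]
  rw [integral_const_mul]
  exact mul_le_mul_of_nonneg_left hX.le (by positivity)

lemma MomentBound.sum {ι : Type*} (s : Finset ι) (hs : s.Nonempty) {X : ι → Ω → ℝ} {p : ℝ}
    (hp : 1 ≤ p) {C : ι → ℝ} (mX : ∀ i, Measurable (X i))
    (hX : ∀ i ∈ s, MomentBound P (X i) p (C i)) :
    MomentBound P (fun ω => ∑ i ∈ s, X i ω) p ((s.card : ℝ) ^ (p - 1) * ∑ i ∈ s, C i) := by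
  refine .of_le (Y := fun ω => (s.card : ℝ) ^ (p - 1) * ∑ i ∈ s, |X i ω| ^ p)
    (by fun_prop) ((integrable_finsetSum _ fun i hi => (hX i hi).integrable).const_mul _)
    (fun ω => ?_) ?_
  -- Triangle inequality, then convexity of `u ↦ u ^ p`, which is where `1 ≤ p` enters.
  · refine (Real.rpow_le_rpow (abs_nonneg _) (Finset.abs_sum_le_sum_abs _ _) (by linarith)).trans ?_
    have := Real.rpow_sum_le_const_mul_sum_rpow s (fun i => X i ω) hp
    exact this
  · rw [integral_const_mul, integral_finsetSum _ fun i hi => (hX i hi).integrable]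
    gcongr with i hi
    exact (hX i hi).le

lemma integrable_truncate [IsFiniteMeasure P] {X : Ω → ℝ} (mX : Measurable X) {K : ℝ}
    (hK : 0 ≤ K) : Integrable (fun ω => truncate K (X ω)) P :=
  .of_bound ((continuous_truncate K).measurable.comp mX).aestronglyMeasurable K
    (ae_of_all _ fun _ => abs_truncate_le hK _)

variable [IsProbabilityMeasure P]

lemma MomentBound.mono_exponent {X : Ω → ℝ} {p q C : ℝ} (mX : Measurable X) (hp : 0 ≤ p)
    (hpq : p ≤ q) (hX : MomentBound P X q C) : MomentBound P X p (1 + C) :=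
  .of_le mX ((integrable_const (1 : ℝ)).add hX.integrable)
    (fun ω => abs_rpow_le_one_add hp hpq (X ω))
    (by
      simp only [Pi.add_apply]
      rw [integral_add (integrable_const _) hX.integrable]
      simpa using hX.le)

lemma MomentBound.integrable_self {X : Ω → ℝ} {p C : ℝ} (mX : Measurable X) (hp : 1 ≤ p)
    (hX : MomentBound P X p C) : Integrable X P := by
  have h := (hX.mono_exponent mX zero_le_one hp).integrable
  simp only [Real.rpow_one] at h
  exact (integrable_norm_iff mX.aestronglyMeasurable).1 h

lemma MomentBound.integral_abs_le {X : Ω → ℝ} {p C : ℝ} (mX : Measurable X) (hp : 1 ≤ p)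
    (hX : MomentBound P X p C) : ∫ ω, |X ω| ∂P ≤ 1 + C := by
  have h := (hX.mono_exponent mX zero_le_one hp).le
  simpa only [Real.rpow_one] using h

lemma MomentBound.integral_abs_sub_truncate_le {X : Ω → ℝ} {η C K : ℝ} (mX : Measurable X)
    (hη : 0 < η) (hK : 0 < K) (hX : MomentBound P X (1 + η) C) :
    ∫ ω, |X ω - truncate K (X ω)| ∂P ≤ K ^ (-η) * C := by
  have hi := hX.integrable_self mX (by linarith)
  calc ∫ ω, |X ω - truncate K (X ω)| ∂P ≤ ∫ ω, K ^ (-η) * |X ω| ^ (1 + η) ∂P :=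
        integral_mono (hi.sub (integrable_truncate mX hK.le)).abs (hX.integrable.const_mul _)
          (fun ω => abs_sub_truncate_le hK hη (X ω))
    _ = K ^ (-η) * ∫ ω, |X ω| ^ (1 + η) ∂P := integral_const_mul _ _
    _ ≤ K ^ (-η) * C := mul_le_mul_of_nonneg_left hX.le (by positivity)

lemma MomentBound.abs_integral_sub_truncate_le {X : Ω → ℝ} {η C K : ℝ} (mX : Measurable X)
    (hη : 0 < η) (hK : 0 < K) (hX : MomentBound P X (1 + η) C) :
    |∫ ω, X ω ∂P - ∫ ω, truncate K (X ω) ∂P| ≤ K ^ (-η) * C := by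
  rw [← integral_sub (hX.integrable_self mX (by linarith)) (integrable_truncate mX hK.le)]
  exact abs_integral_le_integral_abs.trans (hX.integral_abs_sub_truncate_le mX hη hK)

lemma exists_rpow_neg_mul_lt (C : ℝ) {η e : ℝ} (hη : 0 < η) (he : 0 < e) :
    ∃ K : ℝ, 0 < K ∧ K ^ (-η) * C < e := by
  have h : Tendsto (fun K : ℝ => K ^ (-η) * C) atTop (𝓝 (0 * C)) :=
    (tendsto_rpow_neg_atTop hη).mul_const C
  rw [zero_mul] at h
  obtain ⟨K, h1, h2⟩ := ((h.eventually (gt_mem_nhds he)).and (eventually_gt_atTop 0)).exists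
  exact ⟨K, h2, h1⟩

/-- Means converge if the means of all truncations do and a moment of order above one is bounded. -/
lemma tendsto_integral_of_truncate {μ : ℕ → Measure Ω} [∀ n, IsProbabilityMeasure (μ n)]
    {X : ℕ → Ω → ℝ} {Y : Ω → ℝ} {η C : ℝ} (hη : 0 < η) (mX : ∀ n, Measurable (X n))
    (mY : Measurable Y) (hX : ∀ n, MomentBound (μ n) (X n) (1 + η) C)
    (hY : MomentBound P Y (1 + η) C)
    (h : ∀ K, 0 < K → Tendsto (fun n => ∫ ω, truncate K (X n ω) ∂(μ n)) atTop
      (𝓝 (∫ ω, truncate K (Y ω) ∂P))) :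
    Tendsto (fun n => ∫ ω, X n ω ∂(μ n)) atTop (𝓝 (∫ ω, Y ω ∂P)) := by
  rw [Metric.tendsto_atTop]
  intro e he
  -- One level `K` serves all `n` and the limit at once: the two truncation errors and the
  -- convergence at level `K` take `e / 3` each.
  obtain ⟨K, hK, hKe⟩ := exists_rpow_neg_mul_lt C hη (show 0 < e / 3 by linarith)
  obtain ⟨N, hN⟩ := Metric.tendsto_atTop.1 (h K hK) (e / 3) (by linarith)
  refine ⟨N, fun n hn => ?_⟩
  have h1 := (hX n).abs_integral_sub_truncate_le (mX n) hη hK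
  have h2 := hY.abs_integral_sub_truncate_le mY hη hK
  have h3 := hN n hn
  rw [Real.dist_eq] at h3 ⊢
  rw [abs_lt] at h3 ⊢
  rw [abs_le] at h1 h2
  constructor <;> linarith [h1.1, h1.2, h2.1, h2.2, h3.1, h3.2]

end Moments

/-! ### Weak law and mean bounds for arrays with i.i.d. rows. -/

section Rows

variable {Ω : Type*} [MeasurableSpace Ω]

/-- An i.i.d. sequence of measurable real random variables. -/
structure IIDSeq (P : Measure Ω) (Z : ℕ → Ω → ℝ) : Prop where
  measurable : ∀ t, Measurable (Z t)
  indep : iIndepFun Z P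
  ident : ∀ t, IdentDistrib (Z t) (Z 0) P P

variable {P : Measure Ω}

lemma IIDSeq.comp {Z : ℕ → Ω → ℝ} (hZ : IIDSeq P Z) {g : ℝ → ℝ} (hg : Measurable g) :
    IIDSeq P (fun t ω => g (Z t ω)) :=
  ⟨fun t => hg.comp (hZ.measurable t), hZ.indep.comp (fun _ => g) (fun _ => hg),
    fun t => (hZ.ident t).comp hg⟩

lemma IIDSeq.variance_sum {Z : ℕ → Ω → ℝ} (hZ : IIDSeq P Z) (h2 : MemLp (Z 0) 2 P) (n : ℕ) :
    Var[fun ω => ∑ t ∈ Finset.range n, Z t ω; P] = n * Var[Z 0; P] := by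
  have h := IndepFun.variance_sum (X := Z) (s := Finset.range n)
    (fun t _ => (hZ.ident t).memLp_iff.2 h2)
    (fun i _ j _ hij => hZ.indep.indepFun hij)
  have : (fun ω => ∑ t ∈ Finset.range n, Z t ω) = ∑ t ∈ Finset.range n, Z t := by
    ext ω; simp
  rw [this, h, Finset.sum_congr rfl fun t _ => (hZ.ident t).variance_eq]
  simp

lemma IIDSeq.integral_sum {Z : ℕ → Ω → ℝ} (hZ : IIDSeq P Z) (hi : Integrable (Z 0) P) (n : ℕ) :
    ∫ ω, ∑ t ∈ Finset.range n, Z t ω ∂P = n * ∫ ω, Z 0 ω ∂P := by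
  rw [integral_finsetSum _ fun t _ => (hZ.ident t).integrable_iff.2 hi,
    Finset.sum_congr rfl fun t _ => (hZ.ident t).integral_eq]
  simp

lemma IIDSeq.integrable_sum {Z : ℕ → Ω → ℝ} (hZ : IIDSeq P Z) (hi : Integrable (Z 0) P) (n : ℕ) :
    Integrable (fun ω => ∑ t ∈ Finset.range n, Z t ω) P :=
  integrable_finsetSum _ fun t _ => (hZ.ident t).integrable_iff.2 hi

lemma IIDSeq.integral_abs_mean_le {Z : ℕ → Ω → ℝ} (hZ : IIDSeq P Z) (hi : Integrable (Z 0) P)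
    (n : ℕ) : ∫ ω, |(n : ℝ)⁻¹ * ∑ t ∈ Finset.range n, Z t ω| ∂P ≤ ∫ ω, |Z 0 ω| ∂P := by
  have ha : IIDSeq P (fun t ω => |Z t ω|) := hZ.comp (g := fun u => |u|) (by fun_prop)
  calc ∫ ω, |(n : ℝ)⁻¹ * ∑ t ∈ Finset.range n, Z t ω| ∂P
      ≤ ∫ ω, (n : ℝ)⁻¹ * ∑ t ∈ Finset.range n, |Z t ω| ∂P := by
        refine integral_mono ((hZ.integrable_sum hi n).const_mul _).abs
          ((ha.integrable_sum hi.abs n).const_mul _) fun ω => ?_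
        dsimp only
        rw [abs_mul, abs_of_nonneg (by positivity : (0 : ℝ) ≤ (n : ℝ)⁻¹)]
        gcongr
        exact Finset.abs_sum_le_sum_abs _ _
    _ = (n : ℝ)⁻¹ * (n * ∫ ω, |Z 0 ω| ∂P) := by
        rw [integral_const_mul, ha.integral_sum hi.abs]
    _ ≤ ∫ ω, |Z 0 ω| ∂P := by
        rw [← mul_assoc]
        -- This covers `n = 0` too, where `n⁻¹ * n = 0`.
        exact mul_le_of_le_one_left (integral_nonneg fun ω => abs_nonneg _) (inv_mul_le_one)

/-- Turns a variance bound into an `L¹` bound without square roots; `δ` remains free to be taken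
small. -/
lemma abs_le_sq_div_add {δ : ℝ} (hδ : 0 < δ) (u : ℝ) : |u| ≤ u ^ 2 / δ + δ := by
  rw [← sub_nonneg]
  have : u ^ 2 / δ + δ - |u| = ((|u| - δ / 2) ^ 2 + 3 / 4 * δ ^ 2) / δ := by
    rw [← sq_abs u]; field_simp; ring
  rw [this]; positivity

lemma integral_le_integral_add_integral_add {X A B : Ω → ℝ} {c : ℝ} [IsProbabilityMeasure P]
    (hX : Integrable X P) (hA : Integrable A P) (hB : Integrable B P)
    (h : ∀ ω, X ω ≤ A ω + B ω + c) : ∫ ω, X ω ∂P ≤ ∫ ω, A ω ∂P + ∫ ω, B ω ∂P + c := by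
  have hAB : Integrable (fun ω => A ω + B ω) P := hA.add hB
  refine (integral_mono hX (hAB.add (integrable_const c)) h).trans_eq ?_
  simp only [Pi.add_apply]
  rw [integral_add hAB (integrable_const _), integral_add hA hB]
  simp

variable [IsProbabilityMeasure P]

lemma IIDSeq.integral_abs_mean_sub_le_of_bounded {Z : ℕ → Ω → ℝ} (hZ : IIDSeq P Z) {K δ : ℝ}
    (hK : ∀ ω, |Z 0 ω| ≤ K) (hδ : 0 < δ) {n : ℕ} (hn : n ≠ 0) :
    ∫ ω, |(n : ℝ)⁻¹ * ∑ t ∈ Finset.range n, Z t ω - ∫ ω, Z 0 ω ∂P| ∂P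
      ≤ K ^ 2 / δ * (n : ℝ)⁻¹ + δ := by
  have h2 : MemLp (Z 0) 2 P :=
    MemLp.of_bound (hZ.measurable 0).aestronglyMeasurable K (ae_of_all _ hK)
  have hn0 : (n : ℝ) ≠ 0 := by exact_mod_cast hn
  have hi : Integrable (Z 0) P := h2.integrable (by norm_num)
  set S : Ω → ℝ := fun ω => (n : ℝ)⁻¹ * ∑ t ∈ Finset.range n, Z t ω with hS
  have hSi : MemLp S 2 P :=
    (memLp_finsetSum _ fun t _ => (hZ.ident t).memLp_iff.2 h2).const_mul _
  have hmean : ∫ ω, S ω ∂P = ∫ ω, Z 0 ω ∂P := by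
    rw [hS, integral_const_mul, hZ.integral_sum hi, inv_mul_cancel_left₀ hn0]
  have hV : Var[S; P] ≤ K ^ 2 * (n : ℝ)⁻¹ := by
    rw [hS, variance_const_mul, hZ.variance_sum h2]
    have : Var[Z 0; P] ≤ K ^ 2 := by
      refine (variance_le_expectation_sq h2.aestronglyMeasurable).trans ?_
      calc ∫ ω, (Z 0 ^ 2) ω ∂P ≤ ∫ _, K ^ 2 ∂P :=
            integral_mono h2.integrable_sq (integrable_const _)
              fun ω => sq_le_sq' (abs_le.1 (hK ω)).1 (abs_le.1 (hK ω)).2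
        _ = K ^ 2 := by simp
    calc ((n : ℝ)⁻¹) ^ 2 * (n * Var[Z 0; P]) = Var[Z 0; P] * (n : ℝ)⁻¹ := by field_simp
      _ ≤ _ := by gcongr
  rw [← hmean]
  have hD : MemLp (fun ω => S ω - ∫ ω, S ω ∂P) 2 P := hSi.sub (memLp_const _)
  calc ∫ ω, |S ω - ∫ ω, S ω ∂P| ∂P
      ≤ ∫ ω, ((S ω - ∫ ω, S ω ∂P) ^ 2 / δ + δ) ∂P :=
        integral_mono (hD.integrable (by norm_num)).abs
          ((hD.integrable_sq.div_const _).add (integrable_const _))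
          fun ω => abs_le_sq_div_add hδ _
    _ = Var[S; P] / δ + δ := by
        rw [integral_add (hD.integrable_sq.div_const _) (integrable_const _), integral_div,
          variance_eq_integral hSi.aemeasurable]
        simp
    _ ≤ K ^ 2 / δ * (n : ℝ)⁻¹ + δ := by
        rw [div_mul_eq_mul_div]
        gcongr

/-- Each variable is split into its truncation and a remainder. The remainder costs `K ^ (-η) * C`
twice, in the average and in the mean; the truncated part is bounded and is controlled by its
variance. -/
lemma IIDSeq.integral_abs_mean_sub_le {Z : ℕ → Ω → ℝ} (hZ : IIDSeq P Z) {η C K δ : ℝ}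
    (hη : 0 < η) (hC : MomentBound P (Z 0) (1 + η) C) (hK : 0 < K) (hδ : 0 < δ) {n : ℕ}
    (hn : n ≠ 0) :
    ∫ ω, |(n : ℝ)⁻¹ * ∑ t ∈ Finset.range n, Z t ω - ∫ ω, Z 0 ω ∂P| ∂P
      ≤ 2 * (K ^ (-η) * C) + (K ^ 2 / δ * (n : ℝ)⁻¹ + δ) := by
  have hi := hC.integrable_self (hZ.measurable 0) (by linarith)
  have mT := (continuous_truncate K).measurable
  have hT : IIDSeq P (fun t ω => truncate K (Z t ω)) := hZ.comp mT
  have hTi := integrable_truncate (P := P) (hZ.measurable 0) hK.le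
  have hR : IIDSeq P (fun t ω => Z t ω - truncate K (Z t ω)) :=
    hZ.comp (g := fun u => u - truncate K u) (by fun_prop)
  have hRi := hi.sub hTi
  have h1 := hR.integral_abs_mean_le hRi n
  have h2 := hC.integral_abs_sub_truncate_le (hZ.measurable 0) hη hK
  have h3 := hC.abs_integral_sub_truncate_le (hZ.measurable 0) hη hK
  have h4 := hT.integral_abs_mean_sub_le_of_bounded (fun ω => abs_truncate_le hK.le _) hδ hn
  have i1 := ((hR.integrable_sum hRi n).const_mul (n : ℝ)⁻¹).abs
  have i2 := (((hT.integrable_sum hTi n).const_mul (n : ℝ)⁻¹).sub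
    (integrable_const (∫ ω, truncate K (Z 0 ω) ∂P))).abs
  calc ∫ ω, |(n : ℝ)⁻¹ * ∑ t ∈ Finset.range n, Z t ω - ∫ ω, Z 0 ω ∂P| ∂P
      ≤ _ := by
        refine integral_le_integral_add_integral_add
          (((hZ.integrable_sum hi n).const_mul _).sub (integrable_const _)).abs i1 i2
          (c := |∫ ω, Z 0 ω ∂P - ∫ ω, truncate K (Z 0 ω) ∂P|) fun ω => ?_
        have e : (n : ℝ)⁻¹ * ∑ t ∈ Finset.range n, Z t ω - ∫ ω, Z 0 ω ∂P
            = ((n : ℝ)⁻¹ * ∑ t ∈ Finset.range n, (Z t ω - truncate K (Z t ω)))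
              + ((n : ℝ)⁻¹ * ∑ t ∈ Finset.range n, truncate K (Z t ω)
                - ∫ ω, truncate K (Z 0 ω) ∂P)
              - (∫ ω, Z 0 ω ∂P - ∫ ω, truncate K (Z 0 ω) ∂P) := by
          rw [Finset.sum_sub_distrib]; ring
        rw [e]
        exact (abs_sub _ _).trans (add_le_add_left (abs_add_le _ _) _)
    _ ≤ K ^ (-η) * C + (K ^ 2 / δ * (n : ℝ)⁻¹ + δ) + K ^ (-η) * C :=
        add_le_add (add_le_add (h1.trans h2) h4) h3
    _ = _ := by ring

variable {μ : ℕ → Measure Ω}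

lemma boundedInMean_mean {Z : ℕ → ℕ → Ω → ℝ} (hZ : ∀ n, IIDSeq (μ n) (Z n)) {C : ℝ}
    (hi : ∀ n, Integrable (Z n 0) (μ n)) (hC : ∀ n, ∫ ω, |Z n 0 ω| ∂(μ n) ≤ C) :
    BoundedInMean μ (fun (n : ℕ) ω => (n : ℝ)⁻¹ * ∑ t ∈ Finset.range n, Z n t ω) :=
  ⟨C, fun n => ⟨((hZ n).integrable_sum (hi n) n).const_mul _,
    ((hZ n).integral_abs_mean_le (hi n) n).trans (hC n)⟩⟩

variable [∀ n, IsProbabilityMeasure (μ n)]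

/-- Weak law of large numbers for rowwise i.i.d. arrays with a bounded moment of order above one. -/
theorem tendstoInProb_mean {Z : ℕ → ℕ → Ω → ℝ} (hZ : ∀ n, IIDSeq (μ n) (Z n)) {η C m : ℝ}
    (hη : 0 < η) (hC : ∀ n, MomentBound (μ n) (Z n 0) (1 + η) C)
    (hm : Tendsto (fun n : ℕ => ∫ ω, Z n 0 ω ∂(μ n)) atTop (𝓝 m)) :
    TendstoInProb μ (fun (n : ℕ) ω => (n : ℝ)⁻¹ * ∑ t ∈ Finset.range n, Z n t ω) m := by
  have hi : ∀ n, Integrable (Z n 0) (μ n) := fun n =>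
    (hC n).integrable_self ((hZ n).measurable 0) (by linarith)
  have hj : ∀ n : ℕ, Integrable (fun ω => (n : ℝ)⁻¹ * ∑ t ∈ Finset.range n, Z n t ω) (μ n) :=
    fun n => ((hZ n).integrable_sum (hi n) n).const_mul _
  have key : TendstoInProb μ (fun (n : ℕ) ω => (n : ℝ)⁻¹ * ∑ t ∈ Finset.range n, Z n t ω
      - ∫ ω, Z n 0 ω ∂(μ n)) 0 := by
    refine tendstoInProb_of_tendsto_integral (fun n => (hj n).sub (integrable_const _)) ?_
    simp only [sub_zero]
    rw [Metric.tendsto_atTop]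
    intro e he
    -- The remainder enters twice, hence `e / 8`. With `δ = e / 4` and a variance term below `e /
    -- 4`, the total stays below `3e / 4`.
    obtain ⟨K, hK, hKe⟩ := exists_rpow_neg_mul_lt C hη (show 0 < e / 8 by linarith)
    have hlim : Tendsto (fun n : ℕ => K ^ 2 / (e / 4) * (n : ℝ)⁻¹) atTop (𝓝 0) := by
      simpa using (tendsto_inv_atTop_nhds_zero_nat (𝕜 := ℝ)).const_mul (K ^ 2 / (e / 4))
    obtain ⟨N, hN⟩ := Metric.tendsto_atTop.1 hlim (e / 4) (by linarith)
    refine ⟨N + 1, fun n hn => ?_⟩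
    have h1 := (hZ n).integral_abs_mean_sub_le hη (hC n) hK (show 0 < e / 4 by linarith)
      (show n ≠ 0 by omega)
    have h2 := hN n (by omega)
    rw [Real.dist_eq, sub_zero] at h2 ⊢
    rw [abs_of_nonneg (integral_nonneg fun ω => abs_nonneg _)]
    linarith [le_abs_self (K ^ 2 / (e / 4) * (n : ℝ)⁻¹)]
  have := key.add (tendstoInProb_const (μ := μ) _ hm)
  simpa using this

/-- For centred summands the scaled sum has the second moment of one summand (or zero when `n = 0`),
and `|u| ≤ u ^ 2 + 1`. -/
lemma boundedInMean_inv_sqrt_mul_sum {Z : ℕ → ℕ → Ω → ℝ} (hZ : ∀ n, IIDSeq (μ n) (Z n)) {C : ℝ}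
    (h2 : ∀ n, MemLp (Z n 0) 2 (μ n)) (h0 : ∀ n, ∫ ω, Z n 0 ω ∂(μ n) = 0)
    (hC : ∀ n, ∫ ω, Z n 0 ω ^ 2 ∂(μ n) ≤ C) :
    BoundedInMean μ (fun (n : ℕ) ω => (√(n : ℝ))⁻¹ * ∑ t ∈ Finset.range n, Z n t ω) := by
  refine ⟨C + 1, fun n => ?_⟩
  have hi : Integrable (Z n 0) (μ n) := (h2 n).integrable (by norm_num)
  set S : Ω → ℝ := fun ω => (√(n : ℝ))⁻¹ * ∑ t ∈ Finset.range n, Z n t ω with hS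
  have hSm : MemLp S 2 (μ n) :=
    (memLp_finsetSum _ fun t _ => ((hZ n).ident t).memLp_iff.2 (h2 n)).const_mul _
  have hmean : ∫ ω, S ω ∂(μ n) = 0 := by
    rw [hS, integral_const_mul, (hZ n).integral_sum hi, h0]; simp
  have hsq : ∫ ω, S ω ^ 2 ∂(μ n) ≤ C := by
    rw [← variance_of_integral_eq_zero hSm.aemeasurable hmean, hS, variance_const_mul,
      (hZ n).variance_sum (h2 n), variance_of_integral_eq_zero (h2 n).aemeasurable (h0 n),
      inv_pow, Real.sq_sqrt (by positivity), ← mul_assoc]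
    exact (mul_le_of_le_one_left (integral_nonneg fun ω => sq_nonneg _) inv_mul_le_one).trans
      (hC n)
  refine ⟨hSm.integrable (by norm_num), ?_⟩
  calc ∫ ω, |S ω| ∂(μ n) ≤ ∫ ω, (S ω ^ 2 / 1 + 1) ∂(μ n) :=
        integral_mono (hSm.integrable (by norm_num)).abs
          ((hSm.integrable_sq.div_const _).add (integrable_const _))
          fun ω => abs_le_sq_div_add one_pos _
    _ = ∫ ω, S ω ^ 2 ∂(μ n) + 1 := by
        rw [integral_add (hSm.integrable_sq.div_const _) (integrable_const _)]; simp
    _ ≤ C + 1 := by linarith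

end Rows

/-! ### A Lyapunov central limit theorem through characteristic functions. -/

section CLT

variable {Ω : Type*} [MeasurableSpace Ω]

/-- For `|u| ≤ 1` the remainder is cubic, and `|u| ^ 3 ≤ |u| ^ (2 + η)` because `η ≤ 1`. For `|u| ≥
1` every term is dominated by a multiple of `|u| ^ 2`. -/
lemma norm_exp_mul_I_sub_taylor_le {η : ℝ} (h0 : 0 ≤ η) (h1 : η ≤ 1) (u : ℝ) :
    ‖Complex.exp (u * Complex.I) - (1 + u * Complex.I - u ^ 2 / 2)‖ ≤ 4 * |u| ^ (2 + η) := by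
  have hnorm : ‖(u : ℂ) * Complex.I‖ = |u| := by simp
  rcases le_total |u| 1 with h | h
  · have hb := Complex.exp_bound (x := u * Complex.I) (by rwa [hnorm]) (n := 3) (by norm_num)
    have hsum : ∑ m ∈ Finset.range 3, ((u : ℂ) * Complex.I) ^ m / (m.factorial : ℂ)
        = 1 + u * Complex.I - u ^ 2 / 2 := by
      simp only [Finset.sum_range_succ, Finset.sum_range_zero, Nat.factorial, mul_pow,
        Complex.I_sq]
      push_cast
      ring
    rw [hsum, hnorm] at hb
    refine hb.trans ?_
    have h3 : |u| ^ (3 : ℕ) ≤ |u| ^ (2 + η) := by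
      rcases eq_or_lt_of_le (abs_nonneg u) with hu | hu
      · rw [← hu, Real.zero_rpow (by linarith)]; simp
      · rw [← Real.rpow_natCast]
        exact Real.rpow_le_rpow_of_exponent_ge hu h (by push_cast; linarith)
    have h4 : ((Nat.succ 3 : ℕ) : ℝ) * ((Nat.factorial 3 : ℝ) * (3 : ℕ))⁻¹ ≤ 4 := by
      norm_num [Nat.factorial]
    rw [mul_comm]
    exact mul_le_mul h4 h3 (by positivity) (by norm_num)
  · have hsq : |u| ^ (2 : ℝ) ≤ |u| ^ (2 + η) := Real.rpow_le_rpow_of_exponent_le h (by linarith)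
    rw [Real.rpow_two] at hsq
    have hexp : ‖Complex.exp (u * Complex.I)‖ = 1 := Complex.norm_exp_ofReal_mul_I u
    calc ‖Complex.exp (u * Complex.I) - (1 + u * Complex.I - u ^ 2 / 2)‖
        ≤ ‖Complex.exp (u * Complex.I)‖ + (‖(1 : ℂ)‖ + ‖u * Complex.I‖ + ‖(u : ℂ) ^ 2 / 2‖) :=
          (norm_sub_le _ _).trans (add_le_add_right
            ((norm_sub_le _ _).trans (add_le_add_left (norm_add_le _ _) _)) _)
      _ = 2 + |u| + |u| ^ 2 / 2 := by
          rw [hexp, hnorm]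
          simp
          ring
      _ ≤ 4 * |u| ^ 2 := by nlinarith
      _ ≤ 4 * |u| ^ (2 + η) := by linarith

lemma norm_charFun_map_sub_le {P : Measure Ω} [IsProbabilityMeasure P] {Z : Ω → ℝ}
    (mZ : Measurable Z) {η C : ℝ} (h0 : 0 ≤ η) (h1 : η ≤ 1) (hC : MomentBound P Z (2 + η) C)
    (hmean : ∫ ω, Z ω ∂P = 0) (r : ℝ) :
    ‖charFun (P.map Z) r - (1 - r ^ 2 * ((∫ ω, Z ω ^ 2 ∂P : ℝ) : ℂ) / 2)‖
      ≤ 4 * |r| ^ (2 + η) * C := by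
  have hi : Integrable Z P := hC.integrable_self mZ (by linarith)
  have hsq : Integrable (fun ω => Z ω ^ 2) P := by
    have := (hC.mono_exponent mZ (p := 2) (by norm_num) (by linarith)).integrable
    simpa only [Real.rpow_two, sq_abs] using this
  have he : Integrable (fun ω => Complex.exp ((r * Z ω : ℝ) * Complex.I)) P :=
    .of_bound (by fun_prop) 1 (ae_of_all _ fun ω => (Complex.norm_exp_ofReal_mul_I _).le)
  have hZc : Integrable (fun ω => ((r * Z ω : ℝ) : ℂ) * Complex.I) P :=
    ((hi.const_mul r).ofReal (𝕜 := ℂ)).mul_const _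
  have hsqc : Integrable (fun ω => ((r * Z ω : ℝ) : ℂ) ^ 2 / 2) P := by
    have := ((hsq.const_mul (r ^ 2)).ofReal (𝕜 := ℂ)).div_const 2
    refine this.congr (ae_of_all _ fun ω => ?_)
    simp [mul_pow]
  have hT : Integrable (fun ω => 1 + ((r * Z ω : ℝ) : ℂ) * Complex.I
      - ((r * Z ω : ℝ) : ℂ) ^ 2 / 2) P := ((integrable_const 1).add hZc).sub hsqc
  have hcf : charFun (P.map Z) r = ∫ ω, Complex.exp ((r * Z ω : ℝ) * Complex.I) ∂P := by
    rw [charFun_apply_real, integral_map mZ.aemeasurable (by fun_prop)]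
    simp
  have hTint : ∫ ω, (1 + ((r * Z ω : ℝ) : ℂ) * Complex.I - ((r * Z ω : ℝ) : ℂ) ^ 2 / 2) ∂P
      = 1 - r ^ 2 * ((∫ ω, Z ω ^ 2 ∂P : ℝ) : ℂ) / 2 := by
    have e1 : ∫ ω, ((r * Z ω : ℝ) : ℂ) * Complex.I ∂P = 0 := by
      rw [integral_mul_const, integral_complex_ofReal, integral_const_mul, hmean]; simp
    have e2 : ∫ ω, ((r * Z ω : ℝ) : ℂ) ^ 2 / 2 ∂P = r ^ 2 * ((∫ ω, Z ω ^ 2 ∂P : ℝ) : ℂ) / 2 := by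
      rw [integral_div, ← integral_complex_ofReal, ← integral_const_mul]
      simp [mul_pow]
    have h1Z : Integrable (fun ω => 1 + ((r * Z ω : ℝ) : ℂ) * Complex.I) P :=
      (integrable_const 1).add hZc
    rw [integral_sub h1Z hsqc, integral_add (integrable_const 1) hZc, e1, e2]
    simp
  rw [hcf, ← hTint, ← integral_sub he hT]
  calc ‖∫ ω, (Complex.exp ((r * Z ω : ℝ) * Complex.I)
          - (1 + ((r * Z ω : ℝ) : ℂ) * Complex.I - ((r * Z ω : ℝ) : ℂ) ^ 2 / 2)) ∂P‖
      ≤ ∫ ω, 4 * |r| ^ (2 + η) * |Z ω| ^ (2 + η) ∂P := by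
        refine norm_integral_le_of_norm_le (hC.integrable.const_mul _) (ae_of_all _ fun ω => ?_)
        refine (norm_exp_mul_I_sub_taylor_le h0 h1 (r * Z ω)).trans ?_
        rw [abs_mul, Real.mul_rpow (abs_nonneg _) (abs_nonneg _), mul_assoc]
    _ = 4 * |r| ^ (2 + η) * ∫ ω, |Z ω| ^ (2 + η) ∂P := integral_const_mul _ _
    _ ≤ 4 * |r| ^ (2 + η) * C := mul_le_mul_of_nonneg_left hC.le (by positivity)

/-- Central limit theorem for rowwise i.i.d. arrays with a bounded moment of order above two, in
terms of characteristic functions at `1`. -/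
theorem tendsto_charFun_inv_sqrt_mul_sum {μ : ℕ → Measure Ω} [∀ n, IsProbabilityMeasure (μ n)]
    {Z : ℕ → ℕ → Ω → ℝ} (hZ : ∀ n, IIDSeq (μ n) (Z n)) {η C s : ℝ} (hη : 0 < η) (h1 : η ≤ 1)
    (hC : ∀ n, MomentBound (μ n) (Z n 0) (2 + η) C) (hmean : ∀ n, ∫ ω, Z n 0 ω ∂(μ n) = 0)
    (hs : Tendsto (fun n => ∫ ω, Z n 0 ω ^ 2 ∂(μ n)) atTop (𝓝 s)) :
    Tendsto (fun n : ℕ => charFun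
      ((μ n).map fun ω => (√(n : ℝ))⁻¹ * ∑ t ∈ Finset.range n, Z n t ω) 1) atTop
      (𝓝 (Complex.exp (-(s / 2 : ℝ)))) := by
  -- Independence and identical laws make the characteristic function an `n`-th power; it remains to
  -- show that the base is `1 - s / (2n) + o(1 / n)`.
  simp_rw [fun n => charFun_inv_sqrt_mul_sum (hZ n).indep (hZ n).ident (n := n) (t := 1)]
  apply Complex.tendsto_pow_exp_of_isLittleO_sub_add_div
  -- Two errors relative to `1 / n`: the Taylor remainder, of order `n ^ (-(η / 2))`, and the gap
  -- between the row variance and its limit `s`.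
  have hbig : ∀ n : ℕ, n ≠ 0 →
      ‖charFun ((μ n).map (Z n 0)) ((√(n : ℝ))⁻¹ * 1) - (1 + (-(s / 2 : ℝ) : ℂ) / n)‖
        ≤ (4 * C * (n : ℝ) ^ (-(η / 2)) + |s - ∫ ω, Z n 0 ω ^ 2 ∂(μ n)| / 2) * ‖1 / (n : ℂ)‖ := by
    intro n hn
    have hn0 : (0 : ℝ) < n := by positivity
    have hb := norm_charFun_map_sub_le ((hZ n).measurable 0) hη.le h1 (hC n) (hmean n)
      ((√(n : ℝ))⁻¹ * 1)
    set m := ∫ ω, Z n 0 ω ^ 2 ∂(μ n)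
    set f := charFun ((μ n).map (Z n 0)) ((√(n : ℝ))⁻¹ * 1)
    have hr : |(√(n : ℝ))⁻¹ * 1| ^ (2 + η) = (n : ℝ) ^ (-(η / 2)) * (1 / n) := by
      have hinv : 1 / (n : ℝ) = (n : ℝ) ^ (-1 : ℝ) := by rw [Real.rpow_neg_one, one_div]
      rw [mul_one, abs_of_nonneg (by positivity), Real.sqrt_eq_rpow, ← Real.rpow_neg hn0.le,
        ← Real.rpow_mul hn0.le, hinv, ← Real.rpow_add hn0]
      congr 1; ring
    have hr2 : (((√(n : ℝ))⁻¹ * 1 : ℝ) : ℂ) ^ 2 = 1 / n := by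
      rw [← Complex.ofReal_pow, mul_one, inv_pow, Real.sq_sqrt hn0.le]; simp
    rw [hr, hr2] at hb
    have e : f - (1 + (-(s / 2 : ℝ) : ℂ) / n)
        = (f - (1 - 1 / n * (m : ℂ) / 2)) + ((s - m : ℝ) : ℂ) / 2 * (1 / n) := by
      push_cast; ring
    have hnn : ‖1 / (n : ℂ)‖ = 1 / n := by simp
    rw [e, hnn]
    refine (norm_add_le _ _).trans ?_
    have hb2 : ‖((s - m : ℝ) : ℂ) / 2 * (1 / n)‖ = |s - m| / 2 * (1 / n) := by
      rw [norm_mul, hnn, norm_div, Complex.norm_real, Real.norm_eq_abs]; simp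
    rw [hb2]
    linarith
  have hlim : Tendsto (fun n : ℕ => 4 * C * (n : ℝ) ^ (-(η / 2))
      + |s - ∫ ω, Z n 0 ω ^ 2 ∂(μ n)| / 2) atTop (𝓝 0) := by
    have a1 : Tendsto (fun n : ℕ => (n : ℝ) ^ (-(η / 2))) atTop (𝓝 0) :=
      (tendsto_rpow_neg_atTop (by linarith)).comp tendsto_natCast_atTop_atTop
    have a2 := ((hs.const_sub s).abs).div_const 2
    simpa using (a1.const_mul (4 * C)).add a2
  rw [Asymptotics.isLittleO_iff]
  intro e he
  filter_upwards [hlim.eventually (ge_mem_nhds he), eventually_ne_atTop 0] with n h2 h3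
  refine le_trans ?_ (mul_le_mul_of_nonneg_right h2 (norm_nonneg _))
  exact_mod_cast hbig n h3

/-- Random variables whose difference tends to zero in probability have asymptotically equal
characteristic functions. -/
lemma tendsto_charFun_of_sub {μ : ℕ → Measure Ω} [∀ n, IsProbabilityMeasure (μ n)]
    {U V : ℕ → Ω → ℝ} (mU : ∀ n, Measurable (U n)) (mV : ∀ n, Measurable (V n))
    (h : TendstoInProb μ (fun n ω => V n ω - U n ω) 0) {L : ℂ}
    (hU : Tendsto (fun n => charFun ((μ n).map (U n)) 1) atTop (𝓝 L)) :
    Tendsto (fun n => charFun ((μ n).map (V n)) 1) atTop (𝓝 L) := by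
  have cf : ∀ (X : Ω → ℝ) (_ : Measurable X) n, charFun ((μ n).map X) 1
      = ∫ ω, Complex.exp (X ω * Complex.I) ∂(μ n) := fun X mX n => by
    rw [charFun_apply_real, integral_map mX.aemeasurable (by fun_prop)]; simp
  have ie : ∀ (X : Ω → ℝ) (_ : Measurable X) n,
      Integrable (fun ω => Complex.exp (X ω * Complex.I)) (μ n) := fun X mX n =>
    .of_bound (by fun_prop) 1 (ae_of_all _ fun ω => (Complex.norm_exp_ofReal_mul_I _).le)
  suffices hd : Tendsto (fun n => charFun ((μ n).map (V n)) 1 - charFun ((μ n).map (U n)) 1)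
      atTop (𝓝 0) by simpa using hd.add hU
  rw [tendstoInProb_real_iff] at h
  rw [Metric.tendsto_atTop]
  intro e he
  have h2 := h (e / 4) (by linarith)
  have h3 : Tendsto (fun n => (μ n).real {ω | e / 4 ≤ |V n ω - U n ω - 0|}) atTop (𝓝 0) := by
    simpa [Measure.real, Function.comp_def] using (ENNReal.tendsto_toReal ENNReal.zero_ne_top).comp h2
  obtain ⟨N, hN⟩ := Metric.tendsto_atTop.1 h3 (e / 4) (by linarith)
  refine ⟨N, fun n hn => ?_⟩
  have h4 := hN n hn
  rw [Real.dist_eq, sub_zero, abs_of_nonneg measureReal_nonneg] at h4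
  set A := {ω | e / 4 ≤ |V n ω - U n ω - 0|} with hA
  have mA : MeasurableSet A := measurableSet_le measurable_const
    (((mV n).sub (mU n)).sub_const 0).abs
  rw [dist_zero_right, cf _ (mV n), cf _ (mU n), ← integral_sub (ie _ (mV n) n) (ie _ (mU n) n)]
  -- Off `A` the map `u ↦ exp (iu)` is 1-Lipschitz; on `A` the trivial bound `2` is used, and `A`
  -- has measure below `e / 4`.
  have hbound : ∀ ω, ‖Complex.exp (V n ω * Complex.I) - Complex.exp (U n ω * Complex.I)‖
      ≤ e / 4 + A.indicator (fun _ => (2 : ℝ)) ω := by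
    intro ω
    by_cases hω : ω ∈ A
    · rw [Set.indicator_of_mem hω]
      refine (norm_sub_le _ _).trans ?_
      rw [Complex.norm_exp_ofReal_mul_I, Complex.norm_exp_ofReal_mul_I]
      linarith
    · rw [Set.indicator_of_notMem hω, add_zero]
      have hω' : |V n ω - U n ω| < e / 4 := by simpa [hA] using hω
      have e1 : Complex.exp (V n ω * Complex.I) - Complex.exp (U n ω * Complex.I)
          = Complex.exp (U n ω * Complex.I)
            * (Complex.exp (Complex.I * (V n ω - U n ω : ℝ)) - 1) := by
        rw [mul_sub, ← Complex.exp_add, mul_one]; congr 2; push_cast; ring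
      rw [e1, norm_mul, Complex.norm_exp_ofReal_mul_I, one_mul]
      exact (Real.norm_exp_I_mul_ofReal_sub_one_le).trans hω'.le
  have hi : Integrable (fun ω => e / 4 + A.indicator (fun _ => (2 : ℝ)) ω) (μ n) :=
    (integrable_const _).add ((integrable_const _).indicator mA)
  calc _ ≤ ∫ ω, (e / 4 + A.indicator (fun _ => (2 : ℝ)) ω) ∂(μ n) :=
        norm_integral_le_of_norm_le hi (ae_of_all _ hbound)
    _ = e / 4 + 2 * (μ n).real A := by
        rw [integral_add (integrable_const _) ((integrable_const _).indicator mA),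
          integral_indicator_const _ mA]
        simp [mul_comm]
    _ < e := by linarith

end CLT

/-! ### From the model assumptions to a regression array. -/

section Assumptions

variable {Ω : Type*} [MeasurableSpace Ω]

lemma MomentBound.mono {P : Measure Ω} {X : Ω → ℝ} {p C D : ℝ} (hX : MomentBound P X p C)
    (hCD : C ≤ D) : MomentBound P X p D :=
  ⟨hX.integrable, hX.le.trans hCD⟩

/-- Weak convergence together with convergence of a deterministic parameter. -/
lemma tendsto_integral_of_tendstoInDistribution {E T : Type*}
    [TopologicalSpace E] [MeasurableSpace E] [BorelSpace E] [SecondCountableTopology E]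
    [TopologicalSpace.PseudoMetrizableSpace E] [TopologicalSpace T] [MeasurableSpace T] [BorelSpace T]
    [SecondCountableTopology T] [TopologicalSpace.PseudoMetrizableSpace T]
    {μ : ℕ → Measure Ω} [∀ n, IsProbabilityMeasure (μ n)] {P : Measure Ω} [IsProbabilityMeasure P]
    {W : Ω → E} (hW : TendstoInDistribution (fun _ : ℕ => W) atTop W μ P)
    {θ : ℕ → T} {θ₀ : T} (hθ : Tendsto θ atTop (𝓝 θ₀))
    {h : E × T → ℝ} (hc : Continuous h) {K : ℝ} (hK : ∀ p, |h p| ≤ K) :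
    Tendsto (fun n => ∫ ω, h (W ω, θ n) ∂(μ n)) atTop (𝓝 (∫ ω, h (W ω, θ₀) ∂P)) := by
  -- The pair formed by the data and the deterministic parameter has law `law(W) ⊗ δ_θ`. Product
  -- measures depend continuously on their factors, so this joint law converges weakly.
  have h1 := (continuous_diracProba.tendsto θ₀).comp hθ
  have h2 := (ProbabilityMeasure.continuous_prod.tendsto _).comp (hW.tendsto.prodMk_nhds h1)
  have h3 := (ProbabilityMeasure.tendsto_iff_forall_integral_tendsto.1 h2)
    (BoundedContinuousFunction.ofNormedAddCommGroup h hc K hK)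
  have key : ∀ (Q : Measure Ω) [IsProbabilityMeasure Q] (_ : AEMeasurable W Q) (τ : T),
      ∫ p, h p ∂((Q.map W).prod (Measure.dirac τ)) = ∫ ω, h (W ω, τ) ∂Q := by
    intro Q _ hWQ τ
    rw [Measure.prod_dirac, integral_map (by fun_prop) hc.measurable.aestronglyMeasurable,
      integral_map hWQ (by
        exact (hc.measurable.comp (by fun_prop)).aestronglyMeasurable)]
  have h4 := key P hW.aemeasurable_limit θ₀
  have h5 := fun n => key (μ n) (hW.forall_aemeasurable n) (θ n)
  rw [← h4]
  simp only [← h5]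
  exact h3

variable {d : ℕ}

/-- A triangular array of linear regressions with rowwise i.i.d. regressors and errors, bounded
moments and convergent second-moment matrices. -/
structure RegressionArray (μ : ℕ → Measure Ω) (x : ℕ → Ω → Param d) (e : ℕ → ℕ → Ω → ℝ)
    (Om0 S0 : Matrix (Fin (d + 1)) (Fin (d + 1)) ℝ) (η C : ℝ) : Prop where
  pos : 0 < η
  le_one : η ≤ 1
  measurable_x : ∀ t, Measurable (x t)
  measurable_e : ∀ n t, Measurable (e n t)
  iid : ∀ n, ∀ g : Param d × ℝ → ℝ, Measurable g →
    IIDSeq (μ n) (fun t ω => g (x t ω, e n t ω))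
  moment_x : ∀ n j, MomentBound (μ n) (fun ω => x 0 ω j) (2 + η) C
  moment_xe : ∀ n j, MomentBound (μ n) (fun ω => x 0 ω j * e n 0 ω) (2 + η) C
  moment_xxxx : ∀ n i j k l,
    MomentBound (μ n) (fun ω => x 0 ω i * x 0 ω j * x 0 ω k * x 0 ω l) (1 + η) C
  mean_xe : ∀ n j, ∫ ω, x 0 ω j * e n 0 ω ∂(μ n) = 0
  tendsto_xx : ∀ i j, Tendsto (fun n => ∫ ω, x 0 ω i * x 0 ω j ∂(μ n)) atTop (𝓝 (Om0 i j))
  tendsto_xxee : ∀ i j,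
    Tendsto (fun n => ∫ ω, x 0 ω i * x 0 ω j * e n 0 ω ^ 2 ∂(μ n)) atTop (𝓝 (S0 i j))
  posDef_xx : Om0.PosDef
  posDef_xxee : S0.PosDef

lemma measurable_err {y : ℕ → Ω → ℝ} {x : ℕ → Ω → Param d} (hy : ∀ t, Measurable (y t))
    (hx : ∀ t, Measurable (x t)) (θ : Param d) (t : ℕ) : Measurable (err y x θ t) := by
  unfold err dotProduct
  have := hx t
  have := hy t
  fun_prop

/-- The regressor is measurable for the conditioning σ-algebra, so it factors out of the conditional
expectation; integrating gives zero. -/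
lemma integral_mul_eq_zero_of_condExp {P : Measure Ω} [IsProbabilityMeasure P] {X : Ω → Param d}
    (hX : Measurable X) {e : Ω → ℝ} (j : Fin (d + 1)) (he : Integrable e P)
    (hXe : Integrable (fun ω => X ω j * e ω) P)
    (hce : P[e | MeasurableSpace.comap X inferInstance] =ᵐ[P] 0) :
    ∫ ω, X ω j * e ω ∂P = 0 := by
  have hm : MeasurableSpace.comap X inferInstance ≤ (inferInstance : MeasurableSpace Ω) :=
    hX.comap_le
  have hs : StronglyMeasurable[MeasurableSpace.comap X inferInstance] (fun ω => X ω j) :=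
    ((measurable_pi_apply j).comp (comap_measurable X)).stronglyMeasurable
  have h := condExp_mul_of_stronglyMeasurable_left hs hXe he
  have h0 : P[(fun ω => X ω j) * e | MeasurableSpace.comap X inferInstance] =ᵐ[P] 0 := by
    filter_upwards [h, hce] with ω h1 h2
    simp [h1, h2]
  have h2 := integral_condExp hm (μ := P) (f := (fun ω => X ω j) * e)
  rw [integral_congr_ae h0] at h2
  simpa using h2.symm

lemma LinIID1.iid {Φ : Type*} {κ : ℝ} {Ψ : Set (Param d × Φ)} {P : Param d × Φ → Measure Ω}
    {y : ℕ → Ω → ℝ} {x : ℕ → Ω → Param d} (h1 : LinIID1 κ Ψ P y x)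
    (hy : ∀ t, Measurable (y t)) (hx : ∀ t, Measurable (x t)) {ψ : Param d × Φ} (hψ : ψ ∈ Ψ)
    {g : Param d × ℝ → ℝ} (hg : Measurable g) :
    IIDSeq (P ψ) (fun t ω => g (x t ω, err y x ψ.1 t ω)) :=
  ⟨fun t => hg.comp ((hx t).prodMk (measurable_err hy hx ψ.1 t)),
    (h1.indep ψ hψ).comp (fun _ => g) (fun _ => hg), fun t => (h1.ident ψ hψ t).comp hg⟩

/-- The error is a continuous function of the observation and of `θ`, so truncated second moments
converge by weak convergence and `θ_n → θ₀`. The uniform moment bounds then remove the truncation.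
-/
theorem exists_regressionArray {Φ : Type*} [MetricSpace Φ] {Ψ : Set (Param d × Φ)}
    {P : Param d × Φ → Measure Ω} [∀ ψ, IsProbabilityMeasure (P ψ)]
    {y : ℕ → Ω → ℝ} {x : ℕ → Ω → Param d}
    (hy : ∀ t, Measurable (y t)) (hx : ∀ t, Measurable (x t))
    (hweak : InducesWeakConvergence Ψ P y x) {κ : ℝ}
    (h1 : LinIID1 κ Ψ P y x) (h2 : LinIID2 Ψ P x)
    {ψ : ℕ → Param d × Φ} {ψ₀ : Param d × Φ} {b : Fin d → ℝ≥0∞} (hψ : IsDrifting Ψ ψ ψ₀ b) :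
    ∃ η C, RegressionArray (fun n => P (ψ n)) x (fun n => err y x (ψ n).1)
      (momXX (P ψ₀) x 0) (momXXee (P ψ₀) y x ψ₀.1 0) η C := by
  obtain ⟨ν, c, hν, hc⟩ := h1.moments
  obtain ⟨ν', c', hν', -, hc'⟩ := h2
  -- A single exponent for both moment assumptions, capped at one for the Taylor bound in the
  -- central limit theorem.
  set η : ℝ := min (min ν ν') 1
  have hη : 0 < η := lt_min (lt_min hν hν') one_pos
  have hην : η ≤ ν := (min_le_left _ _).trans (min_le_left _ _)
  have hην' : η ≤ ν' := (min_le_left _ _).trans (min_le_right _ _)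
  set C : ℝ := max (1 + max c 0) (1 + max c' 0)
  have hxj : ∀ t j, Measurable fun ω => x t ω j := fun t j =>
    (measurable_pi_apply j).comp (hx t)
  have he := measurable_err hy hx
  have mx : ∀ φ ∈ Ψ, ∀ j, MomentBound (P φ) (fun ω => x 0 ω j) (2 + η) C := fun φ hφ j =>
    ((momentBound_of_lintegral_le (hxj 0 j) (hc φ hφ 0 j).1).mono_exponent (hxj 0 j)
      (by linarith) (by linarith)).mono (le_max_left _ _)
  have mxe : ∀ φ ∈ Ψ, ∀ j, MomentBound (P φ) (fun ω => x 0 ω j * err y x φ.1 0 ω) (2 + η) C :=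
    fun φ hφ j => ((momentBound_of_lintegral_le ((hxj 0 j).mul (he φ.1 0))
      (hc φ hφ 0 j).2).mono_exponent ((hxj 0 j).mul (he φ.1 0))
      (by linarith) (by linarith)).mono (le_max_left _ _)
  -- A product of two variables with moments of order `2 + η` has a moment of order `1 + η / 2`,
  -- still above one.
  have h2p : 2 * (1 + η / 2) = 2 + η := by ring
  have mxx : ∀ φ ∈ Ψ, ∀ i j,
      MomentBound (P φ) (fun ω => x 0 ω i * x 0 ω j) (1 + η / 2) (C + C) := fun φ hφ i j =>
    .mul (by linarith) (hxj 0 i) (hxj 0 j) (by rw [h2p]; exact mx φ hφ i)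
      (by rw [h2p]; exact mx φ hφ j)
  have mxxee : ∀ φ ∈ Ψ, ∀ i j, MomentBound (P φ)
      (fun ω => x 0 ω i * x 0 ω j * err y x φ.1 0 ω ^ 2) (1 + η / 2) (C + C) := by
    intro φ hφ i j
    have := MomentBound.mul (by linarith : 0 ≤ 1 + η / 2) ((hxj 0 i).mul (he φ.1 0))
      ((hxj 0 j).mul (he φ.1 0)) (by rw [h2p]; exact mxe φ hφ i) (by rw [h2p]; exact mxe φ hφ j)
    convert this using 2
    simp only [Pi.mul_apply]
    ring
  have hW : TendstoInDistribution (fun _ : ℕ => obs y x 0) atTop (obs y x 0)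
      (fun n => P (ψ n)) (P ψ₀) :=
    (hweak ψ ψ₀ hψ.mem hψ.mem_limit hψ.tendsto 0 1 le_rfl).continuous_comp continuous_fst
  have hθ : Tendsto (fun n => (ψ n).1) atTop (𝓝 ψ₀.1) :=
    (continuous_fst.tendsto ψ₀).comp hψ.tendsto
  refine ⟨η, C, hη, min_le_right _ _, hx, fun n => he _, fun n g hg => h1.iid hy hx (hψ.mem n) hg,
    fun n => mx _ (hψ.mem n), fun n => mxe _ (hψ.mem n), fun n i j k l => ?_, fun n j => ?_,
    fun i j => ?_, fun i j => ?_, (h1.momXX_mem ψ₀ hψ.mem_limit 0).1,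
    (h1.momXXee_mem ψ₀ hψ.mem_limit 0).1⟩
  · have hm : Measurable fun ω => x 0 ω i * x 0 ω j * x 0 ω k * x 0 ω l :=
      (((hxj 0 i).mul (hxj 0 j)).mul (hxj 0 k)).mul (hxj 0 l)
    exact ((momentBound_of_lintegral_le hm (hc' _ (hψ.mem n) 0 i j k l)).mono_exponent hm
      (by linarith) (by linarith)).mono (le_max_right _ _)
  · exact integral_mul_eq_zero_of_condExp (hx 0) j (h1.integrable_err _ (hψ.mem n) 0)
      ((mxe _ (hψ.mem n) j).integrable_self ((hxj 0 j).mul (he _ 0)) (by linarith))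
      (h1.condExp_err _ (hψ.mem n) 0)
  · refine tendsto_integral_of_truncate (half_pos hη) (fun n => (hxj 0 i).mul (hxj 0 j))
      ((hxj 0 i).mul (hxj 0 j)) (fun n => mxx _ (hψ.mem n) i j) (mxx _ hψ.mem_limit i j)
      fun K hK => ?_
    exact tendsto_integral_of_tendstoInDistribution hW hθ
      (h := fun p => truncate K (p.1.2 i * p.1.2 j)) ((continuous_truncate K).comp (by fun_prop))
      (fun p => abs_truncate_le hK.le _)
  · have hm : ∀ θ, Measurable fun ω => x 0 ω i * x 0 ω j * err y x θ 0 ω ^ 2 := fun θ =>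
      ((hxj 0 i).mul (hxj 0 j)).mul ((he θ 0).pow_const 2)
    refine tendsto_integral_of_truncate (half_pos hη) (fun n => hm _) (hm _)
      (fun n => mxxee _ (hψ.mem n) i j) (mxxee _ hψ.mem_limit i j) fun K hK => ?_
    exact tendsto_integral_of_tendstoInDistribution hW hθ
      (h := fun p => truncate K (p.1.2 i * p.1.2 j * (p.1.1 - p.2 ⬝ᵥ p.1.2) ^ 2))
      ((continuous_truncate K).comp (by unfold dotProduct; fun_prop))
      (fun p => abs_truncate_le hK.le _)

end Assumptions

/-! ### Consistency of least squares, of `Σ̂_n` and of the sandwich matrix. -/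

section LeastSquares

variable {Ω : Type*} {d : ℕ}

/-- `n⁻¹ ∑ x_t e_t`. -/
noncomputable def meanScore (x : ℕ → Ω → Param d) (e : ℕ → Ω → ℝ) (n : ℕ) (ω : Ω) : Param d :=
  fun i => (n : ℝ)⁻¹ * ∑ t ∈ Finset.range n, x t ω i * e t ω

lemma Sxy_eq (y : ℕ → Ω → ℝ) (x : ℕ → Ω → Param d) (θ : Param d) (n : ℕ) (ω : Ω) :
    Sxy y x n ω = Sxx x n ω *ᵥ θ + meanScore x (err y x θ) n ω := by
  ext i
  simp only [Sxy, Sxx, meanScore, err, mulVec, dotProduct, Matrix.of_apply, Pi.add_apply]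
  simp_rw [mul_sub, Finset.sum_sub_distrib, Finset.mul_sum, Finset.sum_mul]
  rw [Finset.sum_comm (s := Finset.range n), mul_sub, Finset.mul_sum]
  rw [← sub_eq_iff_eq_add', ← sub_eq_zero]
  simp_rw [Finset.mul_sum]
  have : ∀ i_1 : Fin (d + 1), ∀ t, (n : ℝ)⁻¹ * (x t ω i * x t ω i_1) * θ i_1
      = (n : ℝ)⁻¹ * (x t ω i * (θ i_1 * x t ω i_1)) := fun _ _ => by ring
  simp_rw [this]
  ring

lemma thetaLS_eq (y : ℕ → Ω → ℝ) (x : ℕ → Ω → Param d) (θ : Param d) {n : ℕ} {ω : Ω}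
    (h : (Sxx x n ω).det ≠ 0) :
    thetaLS y x n ω = θ + (Sxx x n ω)⁻¹ *ᵥ meanScore x (err y x θ) n ω := by
  rw [thetaLS, Sxy_eq y x θ, mulVec_add, mulVec_mulVec,
    Matrix.nonsing_inv_mul _ (isUnit_iff_ne_zero.2 h), one_mulVec]

/-- The residual is `ε_t - (θ̂ - θ)'x_t`; expanding its square separates the estimation error from
averages that involve only regressors and true errors. -/
lemma sigmaHat_eq (y : ℕ → Ω → ℝ) (x : ℕ → Ω → Param d) (θ : Param d) (n : ℕ) (ω : Ω)
    (i j : Fin (d + 1)) :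
    sigmaHat y x n ω i j =
      ((n : ℝ)⁻¹ * ∑ t ∈ Finset.range n, x t ω i * x t ω j * err y x θ t ω ^ 2)
      + (-2) * (∑ k, (thetaLS y x n ω k - θ k) *
          ((n : ℝ)⁻¹ * ∑ t ∈ Finset.range n,
            (x t ω k * err y x θ t ω) * (x t ω i * x t ω j)))
      + ∑ k, ∑ l, (thetaLS y x n ω k - θ k) * (thetaLS y x n ω l - θ l) *
          ((n : ℝ)⁻¹ * ∑ t ∈ Finset.range n, x t ω k * x t ω l * x t ω i * x t ω j) := by
  set δ : Param d := fun k => thetaLS y x n ω k - θ k with hδ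
  have herr : ∀ t, err y x (thetaLS y x n ω) t ω = err y x θ t ω - ∑ k, δ k * x t ω k := by
    intro t
    simp only [err, dotProduct, hδ, sub_mul, Finset.sum_sub_distrib]
    ring
  have hsq : ∀ t, err y x (thetaLS y x n ω) t ω ^ 2 * (x t ω i * x t ω j)
      = x t ω i * x t ω j * err y x θ t ω ^ 2
        + (-2) * ∑ k, δ k * ((x t ω k * err y x θ t ω) * (x t ω i * x t ω j))
        + ∑ k, ∑ l, δ k * δ l * (x t ω k * x t ω l * x t ω i * x t ω j) := by
    intro t
    have a1 : ∑ k, δ k * ((x t ω k * err y x θ t ω) * (x t ω i * x t ω j))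
        = (∑ k, δ k * x t ω k) * (err y x θ t ω * (x t ω i * x t ω j)) := by
      rw [Finset.sum_mul]; exact Finset.sum_congr rfl fun k _ => by ring
    have a2 : ∑ k, ∑ l, δ k * δ l * (x t ω k * x t ω l * x t ω i * x t ω j)
        = (∑ k, δ k * x t ω k) * (∑ l, δ l * x t ω l) * (x t ω i * x t ω j) := by
      rw [Finset.sum_mul_sum, Finset.sum_mul]
      refine Finset.sum_congr rfl fun k _ => ?_
      rw [Finset.sum_mul]; exact Finset.sum_congr rfl fun l _ => by ring
    rw [herr, a1, a2]; ring
  have b1 : ∑ t ∈ Finset.range n, ∑ k, δ k * ((x t ω k * err y x θ t ω) * (x t ω i * x t ω j))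
      = ∑ k, δ k * ∑ t ∈ Finset.range n, (x t ω k * err y x θ t ω) * (x t ω i * x t ω j) := by
    rw [Finset.sum_comm]; simp_rw [Finset.mul_sum]
  have b2 : ∑ t ∈ Finset.range n,
        ∑ k, ∑ l, δ k * δ l * (x t ω k * x t ω l * x t ω i * x t ω j)
      = ∑ k, ∑ l, δ k * δ l *
        ∑ t ∈ Finset.range n, x t ω k * x t ω l * x t ω i * x t ω j := by
    rw [Finset.sum_comm]
    refine Finset.sum_congr rfl fun k _ => ?_
    rw [Finset.sum_comm]; simp_rw [Finset.mul_sum]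
  simp only [sigmaHat, Matrix.of_apply]
  simp_rw [hsq]
  have c1 : ∀ f : Fin (d + 1) → ℝ, ∑ k, δ k * ((n : ℝ)⁻¹ * f k) = (n : ℝ)⁻¹ * ∑ k, δ k * f k :=
    fun f => by
      rw [Finset.mul_sum]; exact Finset.sum_congr rfl fun k _ => mul_left_comm _ _ _
  have c2 : ∀ f : Fin (d + 1) → Fin (d + 1) → ℝ, ∑ k, ∑ l, δ k * δ l * ((n : ℝ)⁻¹ * f k l)
      = (n : ℝ)⁻¹ * ∑ k, ∑ l, δ k * δ l * f k l := fun f => by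
    rw [Finset.mul_sum]
    refine Finset.sum_congr rfl fun k _ => ?_
    rw [Finset.mul_sum]
    exact Finset.sum_congr rfl fun l _ => mul_left_comm _ _ _
  rw [Finset.sum_add_distrib, Finset.sum_add_distrib, ← Finset.mul_sum, b1, b2, c1, c2]
  ring

variable [MeasurableSpace Ω]

lemma measurable_matrix_det {ι : Type*} [Fintype ι] [DecidableEq ι] {A : Ω → Matrix ι ι ℝ}
    (hA : ∀ i j, Measurable fun ω => A ω i j) : Measurable fun ω => (A ω).det := by
  simp only [Matrix.det_apply]
  refine Finset.measurable_fun_sum _ fun σ _ => ?_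
  exact (Finset.measurable_fun_prod _ fun i _ => hA _ _).const_smul _

lemma measurable_matrix_inv {ι : Type*} [Fintype ι] [DecidableEq ι] {A : Ω → Matrix ι ι ℝ}
    (hA : ∀ i j, Measurable fun ω => A ω i j) (i j : ι) : Measurable fun ω => (A ω)⁻¹ i j := by
  -- Through the adjugate, an entry of the inverse is a quotient of two determinants, and this
  -- formula also holds at singular matrices.
  simp only [Matrix.inv_def, Matrix.smul_apply, Ring.inverse_eq_inv', smul_eq_mul,
    Matrix.adjugate_apply]
  refine (measurable_matrix_det hA).inv.mul (measurable_matrix_det fun k l => ?_)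
  by_cases h : k = j
  · subst h; simp
  · simpa [Matrix.updateRow_ne h] using hA k l

lemma measurable_thetaLS {y : ℕ → Ω → ℝ} {x : ℕ → Ω → Param d} (hy : ∀ t, Measurable (y t))
    (hx : ∀ t, Measurable (x t)) (n : ℕ) (i : Fin (d + 1)) :
    Measurable fun ω => thetaLS y x n ω i := by
  have hxj : ∀ t j, Measurable fun ω => x t ω j := fun t j =>
    (measurable_pi_apply j).comp (hx t)
  simp only [thetaLS, mulVec, dotProduct]
  refine Finset.measurable_fun_sum _ fun k _ => (measurable_matrix_inv (fun a b => ?_) i k).mul ?_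
  · simp only [Sxx, Matrix.of_apply]
    exact (Finset.measurable_fun_sum _ fun t _ => (hxj t a).mul (hxj t b)).const_mul _
  · simp only [Sxy]
    exact (Finset.measurable_fun_sum _ fun t _ => (hxj t k).mul (hy t)).const_mul _

variable {μ : ℕ → Measure Ω} {y : ℕ → Ω → ℝ}
  {x : ℕ → Ω → Param d} {e : ℕ → ℕ → Ω → ℝ} {θ : ℕ → Param d}
  {Om0 S0 : Matrix (Fin (d + 1)) (Fin (d + 1)) ℝ} {η C : ℝ}

namespace RegressionArray

lemma measurable_x_apply (hA : RegressionArray μ x e Om0 S0 η C) (t : ℕ) (j : Fin (d + 1)) :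
    Measurable fun ω => x t ω j := (measurable_pi_apply j).comp (hA.measurable_x t)

variable [∀ n, IsProbabilityMeasure (μ n)]

lemma tendsto_Sxx (hA : RegressionArray μ x e Om0 S0 η C) :
    TendstoInProb μ (Sxx x) Om0 := by
  refine TendstoInProb.pi (E := fun _ => Fin (d + 1) → ℝ) fun i =>
    TendstoInProb.pi (E := fun _ => ℝ) fun j => ?_
  have h2p : 2 * (1 + η / 2) = 2 + η := by ring
  have hη := hA.pos
  exact tendstoInProb_mean
    (fun n => hA.iid n (fun p => p.1 i * p.1 j) (by fun_prop)) (half_pos hη)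
    (fun n => MomentBound.mul (by linarith) (hA.measurable_x_apply 0 i) (hA.measurable_x_apply 0 j)
      (by rw [h2p]; exact hA.moment_x n i) (by rw [h2p]; exact hA.moment_x n j))
    (hA.tendsto_xx i j)

lemma tendsto_inv_Sxx (hA : RegressionArray μ x e Om0 S0 η C) :
    TendstoInProb μ (fun n ω => (Sxx x n ω)⁻¹) Om0⁻¹ := by
  refine hA.tendsto_Sxx.comp (f := fun A => A⁻¹) (continuousAt_matrix_inv _ ?_)
  rw [Ring.inverse_eq_inv']
  exact continuousAt_inv₀ hA.posDef_xx.det_pos.ne'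

lemma tendsto_measure_det_eq_zero (hA : RegressionArray μ x e Om0 S0 η C) :
    Tendsto (fun n => μ n {ω | (Sxx x n ω).det = 0}) atTop (𝓝 0) := by
  have hU : {A : Matrix (Fin (d + 1)) (Fin (d + 1)) ℝ | A.det ≠ 0} ∈ 𝓝 Om0 :=
    (isOpen_ne_fun (continuous_id.matrix_det) continuous_const).mem_nhds
      hA.posDef_xx.det_pos.ne'
  have := hA.tendsto_Sxx _ hU
  simpa using this

lemma tendsto_mean_xe (hA : RegressionArray μ x e Om0 S0 η C) (i : Fin (d + 1)) :
    TendstoInProb μ (fun n ω => meanScore x (e n) n ω i) 0 := by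
  -- The weak law is applied with excess exponent `1 + η`, so the moment of order `2 + η` fits
  -- directly.
  have hp : 1 + (1 + η) = 2 + η := by ring
  have hη := hA.pos
  refine tendstoInProb_mean (fun n => hA.iid n (fun p => p.1 i * p.2) (by fun_prop))
    (show 0 < 1 + η by linarith) (fun n => by rw [hp]; exact hA.moment_xe n i) ?_
  simp only [hA.mean_xe]
  exact tendsto_const_nhds

lemma tendsto_mean_xxee (hA : RegressionArray μ x e Om0 S0 η C) (i j : Fin (d + 1)) :
    TendstoInProb μ (fun (n : ℕ) ω =>
      (n : ℝ)⁻¹ * ∑ t ∈ Finset.range n, x t ω i * x t ω j * e n t ω ^ 2) (S0 i j) := by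
  have h2p : 2 * (1 + η / 2) = 2 + η := by ring
  have hη := hA.pos
  refine tendstoInProb_mean
    (fun n => hA.iid n (fun p => p.1 i * p.1 j * p.2 ^ 2) (by fun_prop)) (half_pos hη)
    (C := C + C) (fun n => ?_) (hA.tendsto_xxee i j)
  have := MomentBound.mul (by linarith : 0 ≤ 1 + η / 2)
    ((hA.measurable_x_apply 0 i).mul (hA.measurable_e n 0))
    ((hA.measurable_x_apply 0 j).mul (hA.measurable_e n 0))
    (by rw [h2p]; exact hA.moment_xe n i) (by rw [h2p]; exact hA.moment_xe n j)
  convert this using 2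
  simp only [Pi.mul_apply]
  ring

lemma boundedInMean_xxxx (hA : RegressionArray μ x e Om0 S0 η C) (i j k l : Fin (d + 1)) :
    BoundedInMean μ (fun (n : ℕ) ω =>
      (n : ℝ)⁻¹ * ∑ t ∈ Finset.range n, x t ω i * x t ω j * x t ω k * x t ω l) := by
  have hη := hA.pos
  have hm := hA.measurable_x_apply 0
  have hm4 : Measurable fun ω => x 0 ω i * x 0 ω j * x 0 ω k * x 0 ω l :=
    (((hm i).mul (hm j)).mul (hm k)).mul (hm l)
  exact boundedInMean_mean
    (fun n => hA.iid n (fun p => p.1 i * p.1 j * p.1 k * p.1 l) (by fun_prop))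
    (fun n => (hA.moment_xxxx n i j k l).integrable_self hm4 (by linarith))
    (fun n => (hA.moment_xxxx n i j k l).integral_abs_le hm4 (by linarith))

/-- The factor `x_k ε` has a second moment, and the square of `x_i x_j` is a fourth-order product of
regressors, so the mixed product is integrable. -/
lemma boundedInMean_xexx (hA : RegressionArray μ x e Om0 S0 η C) (k i j : Fin (d + 1)) :
    BoundedInMean μ (fun (n : ℕ) ω =>
      (n : ℝ)⁻¹ * ∑ t ∈ Finset.range n, (x t ω k * e n t ω) * (x t ω i * x t ω j)) := by
  have hη := hA.pos
  have hm := hA.measurable_x_apply 0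
  have hm4 : Measurable fun ω => x 0 ω i * x 0 ω j * x 0 ω i * x 0 ω j :=
    (((hm i).mul (hm j)).mul (hm i)).mul (hm j)
  have hb : ∀ n, MomentBound (μ n) (fun ω => (x 0 ω k * e n 0 ω) * (x 0 ω i * x 0 ω j)) 1
      ((1 + C) + (1 + C)) := by
    intro n
    refine .mul zero_le_one ((hm k).mul (hA.measurable_e n 0)) ((hm i).mul (hm j)) ?_ ?_
    · exact (hA.moment_xe n k).mono_exponent ((hm k).mul (hA.measurable_e n 0))
        (by norm_num) (by linarith)
    · have h4 := (hA.moment_xxxx n i j i j).mono_exponent hm4 zero_le_one (by linarith)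
      refine .of_le ((hm i).mul (hm j)) h4.integrable (fun ω => le_of_eq ?_) h4.le
      rw [mul_one, Real.rpow_two, Real.rpow_one, sq, ← abs_mul]
      congr 1
      ring
  have hmz : ∀ n, Measurable fun ω => (x 0 ω k * e n 0 ω) * (x 0 ω i * x 0 ω j) := fun n =>
    ((hm k).mul (hA.measurable_e n 0)).mul ((hm i).mul (hm j))
  exact boundedInMean_mean
    (fun n => hA.iid n (fun p => (p.1 k * p.2) * (p.1 i * p.1 j)) (by fun_prop))
    (fun n => (hb n).integrable_self (hmz n) le_rfl)
    (fun n => (hb n).integral_abs_le (hmz n) le_rfl)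

lemma memLp_xe (hA : RegressionArray μ x e Om0 S0 η C) (n : ℕ) (j : Fin (d + 1)) :
    MemLp (fun ω => x 0 ω j * e n 0 ω) 2 (μ n) := by
  have hη := hA.pos
  have hm : Measurable fun ω => x 0 ω j * e n 0 ω :=
    (hA.measurable_x_apply 0 j).mul (hA.measurable_e n 0)
  rw [memLp_two_iff_integrable_sq hm.aestronglyMeasurable]
  have := ((hA.moment_xe n j).mono_exponent hm (p := 2) (by norm_num) (by linarith)).integrable
  simpa only [Real.rpow_two, sq_abs] using this

lemma boundedInMean_score (hA : RegressionArray μ x e Om0 S0 η C) (j : Fin (d + 1)) :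
    BoundedInMean μ (fun (n : ℕ) ω => √(n : ℝ) * meanScore x (e n) n ω j) := by
  have hη := hA.pos
  have h := boundedInMean_inv_sqrt_mul_sum
    (fun n => hA.iid n (fun p => p.1 j * p.2) (by fun_prop)) (C := 1 + C)
    (fun n => hA.memLp_xe n j) (fun n => hA.mean_xe n j) (fun n => by
      have hm : Measurable fun ω => x 0 ω j * e n 0 ω :=
        (hA.measurable_x_apply 0 j).mul (hA.measurable_e n 0)
      have := ((hA.moment_xe n j).mono_exponent hm (p := 2) (by norm_num) (by linarith)).le
      simpa only [Real.rpow_two, sq_abs] using this)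
  have hs : ∀ n : ℕ, √(n : ℝ) * (n : ℝ)⁻¹ = (√(n : ℝ))⁻¹ := fun n => by
    rw [← div_eq_mul_inv, Real.sqrt_div_self', one_div]
  simpa only [meanScore, ← mul_assoc, hs] using h

lemma tendsto_thetaLS (hA : RegressionArray μ x (fun n => err y x (θ n)) Om0 S0 η C)
    (i : Fin (d + 1)) : TendstoInProb μ (fun n ω => thetaLS y x n ω i - θ n i) 0 := by
  have h1 : TendstoInProb μ
      (fun n ω => ((Sxx x n ω)⁻¹ *ᵥ meanScore x (err y x (θ n)) n ω) i) 0 := by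
    have := (hA.tendsto_inv_Sxx.prodMk (TendstoInProb.pi (E := fun _ => ℝ) (v := 0)
      hA.tendsto_mean_xe)).comp (f := fun p => (p.1 *ᵥ p.2) i)
      (Continuous.continuousAt ((continuous_apply i).comp
        (Continuous.matrix_mulVec continuous_fst continuous_snd)))
    simpa using this
  refine h1.congr (tendsto_measure_zero_of_subset (fun n ω hω => ?_)
    hA.tendsto_measure_det_eq_zero)
  by_contra hdet
  apply hω
  rw [thetaLS_eq y x (θ n) hdet]
  simp

/-- In the expansion `sigmaHat_eq` the linear and quadratic terms carry factors `θ̂ - θ_n`, which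
vanish in probability, against averages bounded in mean. -/
theorem tendsto_sigmaHat (hA : RegressionArray μ x (fun n => err y x (θ n)) Om0 S0 η C) :
    TendstoInProb μ (sigmaHat y x) S0 := by
  refine TendstoInProb.pi (E := fun _ => Fin (d + 1) → ℝ) fun i =>
    TendstoInProb.pi (E := fun _ => ℝ) fun j => ?_
  have h2 := TendstoInProb.const_mul (-2) (TendstoInProb.sum Finset.univ fun k _ =>
    (hA.tendsto_thetaLS k).mul_boundedInMean (hA.boundedInMean_xexx k i j))
  have h3 := TendstoInProb.sum Finset.univ fun k _ => TendstoInProb.sum Finset.univ fun l _ => by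
    have := (hA.tendsto_thetaLS k).mul (hA.tendsto_thetaLS l)
    rw [mul_zero] at this
    exact this.mul_boundedInMean (hA.boundedInMean_xxxx k l i j)
  have h := ((hA.tendsto_mean_xxee i j).add h2).add h3
  simp only [Finset.sum_const_zero, mul_zero, add_zero] at h
  simpa only [← sigmaHat_eq y x (θ _)] using h

theorem tendsto_sandwich (hA : RegressionArray μ x (fun n => err y x (θ n)) Om0 S0 η C) :
    TendstoInProb μ (fun n ω => (Sxx x n ω)⁻¹ * sigmaHat y x n ω * (Sxx x n ω)⁻¹)
      (Om0⁻¹ * S0 * Om0⁻¹) :=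
  (hA.tendsto_inv_Sxx.prodMk hA.tendsto_sigmaHat).comp
    (f := fun p => p.1 * p.2 * p.1) (Continuous.continuousAt
      ((continuous_fst.matrix_mul continuous_snd).matrix_mul continuous_fst))

end RegressionArray

end LeastSquares

/-! ### Asymptotic normality of the estimator of `β`. -/

section Normality

variable {Ω : Type*} [MeasurableSpace Ω] {d : ℕ} {μ : ℕ → Measure Ω}
  {y : ℕ → Ω → ℝ} {x : ℕ → Ω → Param d} {e : ℕ → ℕ → Ω → ℝ}
  {θ : ℕ → Param d} {Om0 S0 : Matrix (Fin (d + 1)) (Fin (d + 1)) ℝ} {η C : ℝ}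

lemma selBeta_mul (A : Matrix (Fin (d + 1)) (Fin (d + 1)) ℝ) :
    selBeta d * A = A.submatrix Fin.succ id := by
  ext i j
  simp [selBeta, Matrix.mul_apply]

lemma mul_transpose_selBeta {m : ℕ} (A : Matrix (Fin m) (Fin (d + 1)) ℝ) :
    A * (selBeta d)ᵀ = A.submatrix id Fin.succ := by
  ext i j
  simp [selBeta, Matrix.mul_apply]

lemma sigmaBeta_eq_submatrix (Om0 S0 : Matrix (Fin (d + 1)) (Fin (d + 1)) ℝ) :
    sigmaBeta Om0 S0 = (Om0⁻¹ * S0 * Om0⁻¹).submatrix Fin.succ Fin.succ := by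
  rw [sigmaBeta, mul_transpose_selBeta, Matrix.mul_assoc, Matrix.mul_assoc, selBeta_mul,
    ← Matrix.mul_assoc]
  rfl

/-- This form shows positive semidefiniteness and identifies the variance of `s'H_β Ω₀⁻¹ · score`
with the Gaussian quadratic form at `s`. -/
lemma sigmaBeta_eq_conj {Om0 S0 : Matrix (Fin (d + 1)) (Fin (d + 1)) ℝ} (hOm : Om0.IsHermitian) :
    sigmaBeta Om0 S0 = (selBeta d * Om0⁻¹) * S0 * (selBeta d * Om0⁻¹)ᵀ := by
  have h : (Om0⁻¹)ᵀ = Om0⁻¹ := by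
    have := hOm.inv
    rwa [Matrix.IsHermitian, Matrix.conjTranspose_eq_transpose_of_trivial] at this
  rw [Matrix.transpose_mul, h, sigmaBeta, ← Matrix.mul_assoc]

lemma posSemidef_sigmaBeta {Om0 S0 : Matrix (Fin (d + 1)) (Fin (d + 1)) ℝ}
    (hOm : Om0.IsHermitian) (hS : S0.PosSemidef) : (sigmaBeta Om0 S0).PosSemidef := by
  rw [sigmaBeta_eq_conj hOm, ← Matrix.conjTranspose_eq_transpose_of_trivial]
  exact hS.mul_mul_conjTranspose_same _

lemma TendstoInProb.matrixTendstoInProb {m : ℕ} {A : ℕ → Ω → Matrix (Fin m) (Fin m) ℝ}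
    {B : Matrix (Fin m) (Fin m) ℝ} (h : TendstoInProb μ A B) : MatrixTendstoInProb μ A B :=
  fun i j => tendstoInProb_real_iff.1
    (h.comp (f := fun M => M i j) (continuous_id.matrix_elem i j).continuousAt)

variable [∀ n, IsProbabilityMeasure (μ n)]

namespace RegressionArray

/-- The Cramér–Wold step: a fixed linear combination of score coordinates is a scaled sum of centred
i.i.d. scalars whose variance tends to `a'S0 a`. -/
lemma tendsto_charFun_score (hA : RegressionArray μ x e Om0 S0 η C) (a : Param d) :
    Tendsto (fun n : ℕ => charFun ((μ n).map fun ω =>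
      ∑ k, a k * (√(n : ℝ) * meanScore x (e n) n ω k)) 1) atTop
      (𝓝 (Complex.exp (-(a ⬝ᵥ S0 *ᵥ a / 2 : ℝ)))) := by
  have hη := hA.pos
  have hm : ∀ n k, Measurable fun ω => x 0 ω k * e n 0 ω := fun n k =>
    (hA.measurable_x_apply 0 k).mul (hA.measurable_e n 0)
  have hi : ∀ n k, Integrable (fun ω => x 0 ω k * e n 0 ω) (μ n) := fun n k =>
    (hA.memLp_xe n k).integrable (by norm_num)
  have hii : ∀ n k l, Integrable (fun ω => (x 0 ω k * e n 0 ω) * (x 0 ω l * e n 0 ω)) (μ n) :=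
    fun n k l => (hA.memLp_xe n k).integrable_mul (hA.memLp_xe n l)
  have hlim : Tendsto (fun n => ∫ ω, (∑ k, a k * (x 0 ω k * e n 0 ω)) ^ 2 ∂(μ n)) atTop
      (𝓝 (a ⬝ᵥ S0 *ᵥ a)) := by
    have h1 : ∀ n, ∫ ω, (∑ k, a k * (x 0 ω k * e n 0 ω)) ^ 2 ∂(μ n)
        = ∑ k, a k * ∑ l, (∫ ω, x 0 ω k * x 0 ω l * e n 0 ω ^ 2 ∂(μ n)) * a l := by
      intro n
      have h2 : ∀ ω, (∑ k, a k * (x 0 ω k * e n 0 ω)) ^ 2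
          = ∑ k, ∑ l, (a k * a l) * ((x 0 ω k * e n 0 ω) * (x 0 ω l * e n 0 ω)) := fun ω => by
        rw [sq, Finset.sum_mul_sum]
        exact Finset.sum_congr rfl fun k _ => Finset.sum_congr rfl fun l _ => by ring
      simp only [h2]
      rw [integral_finsetSum _ fun k _ => integrable_finsetSum _ fun l _ =>
        (hii n k l).const_mul _]
      refine Finset.sum_congr rfl fun k _ => ?_
      rw [integral_finsetSum _ fun l _ => (hii n k l).const_mul _, Finset.mul_sum]
      refine Finset.sum_congr rfl fun l _ => ?_
      rw [integral_const_mul, mul_comm (∫ ω, _ ∂_) (a l), ← mul_assoc]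
      congr 2
      ext ω
      ring
    simp only [h1, dotProduct, mulVec]
    exact tendsto_finsetSum _ fun k _ => (tendsto_finsetSum _ fun l _ =>
      (hA.tendsto_xxee k l).mul_const _).const_mul _
  have key := tendsto_charFun_inv_sqrt_mul_sum
    (fun n => hA.iid n (fun p => ∑ k, a k * (p.1 k * p.2)) (by fun_prop)) hη hA.le_one
    (fun n => MomentBound.sum Finset.univ Finset.univ_nonempty (by linarith)
      (fun k => (hm n k).const_mul (a k)) fun k _ => (hA.moment_xe n k).const_mul (a k))
    (fun n => by
      rw [integral_finsetSum _ fun k _ => (hi n k).const_mul _]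
      simp only [integral_const_mul, hA.mean_xe, mul_zero, Finset.sum_const_zero]) hlim
  refine key.congr fun n => ?_
  congr 2
  ext ω
  have hs : √(n : ℝ) * (n : ℝ)⁻¹ = (√(n : ℝ))⁻¹ := by
    rw [← div_eq_mul_inv, Real.sqrt_div_self', one_div]
  simp only [meanScore, ← mul_assoc _ (n : ℝ)⁻¹, hs]
  rw [Finset.sum_comm, Finset.mul_sum]
  refine Finset.sum_congr rfl fun k _ => ?_
  rw [← Finset.mul_sum]
  ring

/-- Where `S_xx` is invertible, the difference is linear in the scaled score with coefficients from
`S_xx⁻¹ - Ω₀⁻¹`. These vanish in probability while the scaled score stays bounded in mean. -/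
lemma tendsto_betaCheck_sub_score
    (hA : RegressionArray μ x (fun n => err y x (θ n)) Om0 S0 η C) (s : Fin d → ℝ) :
    TendstoInProb μ (fun (n : ℕ) ω =>
      (∑ j, s j * (√(n : ℝ) * (betaCheck y x n ω j - betaPart (θ n) j)))
        - ∑ k, (s ᵥ* (selBeta d * Om0⁻¹)) k
            * (√(n : ℝ) * meanScore x (err y x (θ n)) n ω k)) 0 := by
  have hinv : ∀ i k, TendstoInProb μ (fun n ω => (Sxx x n ω)⁻¹ i k - Om0⁻¹ i k) 0 := by
    intro i k
    have := hA.tendsto_inv_Sxx.comp (f := fun A => A i k - Om0⁻¹ i k)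
      (Continuous.continuousAt ((continuous_id.matrix_elem i k).sub continuous_const))
    simpa using this
  have h1 := TendstoInProb.sum (Finset.univ : Finset (Fin d)) fun j _ =>
    (TendstoInProb.sum (Finset.univ : Finset (Fin (d + 1))) fun k _ =>
      (hinv j.succ k).mul_boundedInMean (hA.boundedInMean_score k)).const_mul (s j)
  simp only [Finset.sum_const_zero, mul_zero] at h1
  refine h1.congr (tendsto_measure_zero_of_subset (fun n ω hω => ?_)
    hA.tendsto_measure_det_eq_zero)
  by_contra hdet
  apply hω
  have h2 : ∀ j, betaCheck y x n ω j - betaPart (θ n) j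
      = ∑ k, (Sxx x n ω)⁻¹ j.succ k * meanScore x (err y x (θ n)) n ω k := fun j => by
    simp only [betaCheck, betaPart]
    rw [thetaLS_eq y x (θ n) hdet]
    simp [mulVec, dotProduct]
  have h3 : ∀ k, (s ᵥ* (selBeta d * Om0⁻¹)) k = ∑ j, s j * Om0⁻¹ j.succ k := fun k => by
    rw [selBeta_mul]
    simp [vecMul, dotProduct]
  simp only [h2, h3, Finset.sum_mul]
  rw [Finset.sum_comm (s := (Finset.univ : Finset (Fin (d + 1)))), ← Finset.sum_sub_distrib]
  refine Finset.sum_congr rfl fun j _ => ?_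
  rw [Finset.mul_sum, Finset.mul_sum, Finset.mul_sum, ← Finset.sum_sub_distrib]
  exact Finset.sum_congr rfl fun k _ => by ring

theorem tendstoInDistribution_betaCheck
    (hA : RegressionArray μ x (fun n => err y x (θ n)) Om0 S0 η C)
    (hy : ∀ t, Measurable (y t)) :
    TendstoInDistribution
      (fun (n : ℕ) ω => WithLp.toLp 2
          (fun j => √(n : ℝ) * (betaCheck y x n ω j - betaPart (θ n) j)) :
        (n : ℕ) → Ω → EuclideanSpace ℝ (Fin d))
      atTop id μ (multivariateGaussian 0 (sigmaBeta Om0 S0)) := by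
  have hx := hA.measurable_x
  have mcoord : ∀ (n : ℕ) j, Measurable fun ω =>
      √(n : ℝ) * (betaCheck y x n ω j - betaPart (θ n) j) := fun n j =>
    ((measurable_thetaLS hy hx n j.succ).sub_const _).const_mul _
  have mV : ∀ n : ℕ, Measurable fun ω => (WithLp.toLp 2
      (fun j => √(n : ℝ) * (betaCheck y x n ω j - betaPart (θ n) j)) :
        EuclideanSpace ℝ (Fin d)) := fun n =>
    (WithLp.measurable_toLp 2 _).comp (measurable_pi_lambda _ (mcoord n))
  refine ⟨fun n => (mV n).aemeasurable, aemeasurable_id, ?_⟩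
  -- Lévy's continuity theorem. The characteristic function of the vector at `s` is that of its
  -- inner product with `s` at `1`, which reduces the claim to scalars.
  refine ProbabilityMeasure.tendsto_iff_tendsto_charFun.2 fun s => ?_
  have hOm := hA.posDef_xx.isHermitian
  have mscore : ∀ n k, Measurable fun ω => meanScore x (err y x (θ n)) n ω k := fun n k =>
    (Finset.measurable_fun_sum _ fun t _ =>
      (hA.measurable_x_apply t k).mul (hA.measurable_e n t)).const_mul _
  have hlim := tendsto_charFun_of_sub
    (fun n => Finset.measurable_fun_sum _ fun k _ => ((mscore n k).const_mul _).const_mul _)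
    (fun n => Finset.measurable_fun_sum _ fun j _ => (mcoord n j).const_mul (s j))
    (hA.tendsto_betaCheck_sub_score s)
    (hA.tendsto_charFun_score (WithLp.ofLp s ᵥ* (selBeta d * Om0⁻¹)))
  have hcf : charFun (multivariateGaussian 0 (sigmaBeta Om0 S0)) s
      = Complex.exp (-((WithLp.ofLp s ᵥ* (selBeta d * Om0⁻¹)) ⬝ᵥ
          S0 *ᵥ (WithLp.ofLp s ᵥ* (selBeta d * Om0⁻¹)) / 2 : ℝ)) := by
    rw [charFun_multivariateGaussian (posSemidef_sigmaBeta hOm hA.posDef_xxee.posSemidef),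
      sigmaBeta_eq_conj hOm, ← Matrix.mulVec_mulVec, ← Matrix.mulVec_mulVec,
      Matrix.dotProduct_mulVec, Matrix.mulVec_transpose]
    simp
  simp only [ProbabilityMeasure.coe_mk, Measure.map_id]
  rw [hcf]
  refine hlim.congr fun n => ?_
  rw [charFun_apply_real, charFun_apply, integral_map (by
      exact (Finset.measurable_fun_sum _ fun j _ => (mcoord n j).const_mul (s j)).aemeasurable)
      (by fun_prop), integral_map (mV n).aemeasurable (by fun_prop)]
  congr 1
  ext ω
  simp [PiLp.inner_apply]

end RegressionArray

end Normality

end BoundaryRegression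

theorem proposition3 {d : ℕ} {Φ : Type*} [MetricSpace Φ] [CompactSpace Φ]
    (Φset : BoundaryRegression.Param d → Set Φ)
    {Ω : Type*} [MeasurableSpace Ω]
    (P : BoundaryRegression.Param d × Φ → Measure Ω) [∀ ψ, IsProbabilityMeasure (P ψ)]
    (y : ℕ → Ω → ℝ) (x : ℕ → Ω → BoundaryRegression.Param d)
    (hy : ∀ t, Measurable (y t)) (hx : ∀ t, Measurable (x t))
    (hweak : BoundaryRegression.InducesWeakConvergence
      (BoundaryRegression.paramSpace Φset) P y x)
    (κ : ℝ) (hκ : 0 < κ)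
    (h1 : BoundaryRegression.LinIID1 κ (BoundaryRegression.paramSpace Φset) P y x)
    (h2 : BoundaryRegression.LinIID2 (BoundaryRegression.paramSpace Φset) P x)
    (ψ : ℕ → BoundaryRegression.Param d × Φ) (ψ₀ : BoundaryRegression.Param d × Φ)
    (b : Fin d → ℝ≥0∞)
    (hψ : BoundaryRegression.IsDrifting (BoundaryRegression.paramSpace Φset) ψ ψ₀ b) :
    BoundaryRegression.CovarianceConsistency (fun n => P (ψ n))
      (BoundaryRegression.sigmaHat y x)
      (BoundaryRegression.momXXee (P ψ₀) y x ψ₀.1 0) ∧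
    BoundaryRegression.AsymptoticNormality (fun n => P (ψ n))
      (fun n => BoundaryRegression.betaPart (ψ n).1)
      (BoundaryRegression.betaCheck y x) (BoundaryRegression.sigmaBetaCheck y x)
      (BoundaryRegression.momXX (P ψ₀) x 0)
      (BoundaryRegression.momXXee (P ψ₀) y x ψ₀.1 0) := by
  obtain ⟨η, C, hA⟩ := BoundaryRegression.exists_regressionArray hy hx hweak h1 h2 hψ
  refine ⟨hA.tendsto_sigmaHat.matrixTendstoInProb, hA.tendstoInDistribution_betaCheck hy, ?_⟩
  -- As `Σ_β` is a block of the full sandwich limit, entrywise convergence is inherited from the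
  -- full matrix.
  rw [BoundaryRegression.sigmaBeta_eq_submatrix]
  exact fun i j => hA.tendsto_sandwich.matrixTendstoInProb i.succ j.succ
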